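/- Fix an algebraic closure $\mathbb{Q}^c$ of $\mathbb{Q}$. For $n\ge 1$ let $\mu_n\subset\mathbb{Q}^{c,\times}$ be the group of $n$-th roots of unity, $\mathbb{Q}(n)=\mathbb{Q}(\mu_n)$, and let $\mu_\infty^*$ be the set of all roots of unity different from $1$. Put $R=\varprojlim_n\mathbb{Z}[\mathrm{Gal}(\mathbb{Q}(n)/\mathbb{Q})]$ (transition maps induced by restriction), and let $\tau\in R$ be the element given by complex conjugation. Let $\mathcal{F}$ be the multiplicative group of functions $f:\mu_\infty^*\to\mathbb{Q}^{c,\times}$ that commute with the action of $\mathrm{Gal}(\mathbb{Q}^c/\mathbb{Q})$. If $\zeta\in\mu_n$ then $f(\zeta)\in\mathbb{Q}(n)^\times$, so $\mathcal{F}$ is an $R$-module, and we write the action of $R$ exponentially or as multiplication. Let $\mathcal{F}^{\rm d}\subseteq\mathcal{F}$ be the $R$-submodule of (circular) distributions, i.e. of those $f$ with $\prod_{\zeta^a=\varepsilon}f(\zeta)=f(\varepsilon)$ for all natural numbers $a\ge1$ and all $\varepsilon\in\mu_\infty^*$. Let $\mathcal{F}^{\rm sd}\subseteq\mathcal{F}^{\rm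 d}$ be the $R$-submodule of strict distributions, i.e. of those $f\in\mathcal{F}^{\rm d}$ with $f(\varepsilon\zeta)\equiv f(\zeta)$ modulo all primes above $\ell$, for all $n\ge1$, all primes $\ell$ coprime to $n$, all $\varepsilon\in\mu_\ell$ and all $\zeta\in\mu_n\setminus\{1\}$. Let $\Phi\in\mathcal{F}^{\rm sd}$ be the function $\Phi(\zeta)=1-\zeta$ and let $\mathcal{F}^{\rm c}=R\cdot\Phi$ be the $R$-submodule generated by $\Phi$. For an $R$-module $M$ let $M_{\rm tor}$ be the submodule of elements of finite order and $M_{\rm tf}=M/M_{\rm tor}$. Let $\mathcal{F}^{\rm d}_{\rm tv}$ be the $R$-submodule of those $f\in\mathcal{F}^{\rm d}$ for which every value $f(\zeta)$ has finite order. Let $\widehat{\mathbb{Z}}(1)=\varprojlim_m\mu_m$ with transition maps $\mu_m\to\mu_{m'}$, $x\mapsto x^{m/m'}$, for $m'\mid m$, regarded as an $R$-module. Let $(\zeta_m)_m$ be any element of $\widehat{\mathbb{Z}}(1)$ such that $\zeta_m$ generates $\mu_m$ for every $m$. **Theorem.** (i) $\mathcal{F}^{\rm d}_{\rm tv}=\mathcal{F}^{\rm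 d}_{\rm tor}+(1-\tau)\mathcal{F}^{\rm c}$, and $\mathcal{F}^{\rm d}_{\rm tv}$ is also the kernel of the endomorphism of $\mathcal{F}^{\rm d}$ given by multiplication by $1+\tau$. (ii) There are isomorphisms of $R$-modules $$\mathcal{F}^{\rm d}_{\rm tv}/\mathcal{F}^{\rm d}_{\rm tor}\;\cong\;(1-\tau)\mathcal{F}^{\rm c}\;\cong\;\widehat{\mathbb{Z}}(1).$$ The first is induced by the equality $\mathcal{F}^{\rm d}_{\rm tv}=\mathcal{F}^{\rm d}_{\rm tor}+(1-\tau)\mathcal{F}^{\rm c}$, that is, it sends the class of each $f\in(1-\tau)\mathcal{F}^{\rm c}$ to $f$. The second sends $\Phi^{1-\tau}$ to $(\zeta_m)_m$. (iii) If $\mathcal{F}^*$ denotes either $\mathcal{F}^{\rm d}$ or $\mathcal{F}^{\rm sd}$, then the homomorphism of $R$-modules $$\mathcal{F}^*_{\rm tf}/\mathcal{F}^{\rm c}\;\longrightarrow\;(1+\tau)\mathcal{F}^*/(1+\tau)\mathcal{F}^{\rm c}$$ that is induced by multiplication by $1+\tau$ (where $\mathcal{F}^{\rm c}$ on the left stands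 for its image in $\mathcal{F}^*_{\rm tf}$) is well defined and bijective. -/

import Mathlib

open scoped Pointwise

set_option linter.unusedSectionVars false

noncomputable section

namespace CircDist

/-- For a normal extension `E/F` and an `F`-embedding `i : E → M`, the restriction homomorphism
`Gal(M/F) → Gal(E/F)`. -/
def resAlong {F E M : Type*} [Field F] [Field E] [Field M] [Algebra F E] [Algebra F M]
    [Normal F E] (i : E →ₐ[F] M) : Gal(M/F) →* Gal(E/F) :=
  letI : Algebra E M := i.toRingHom.toAlgebra
  haveI : IsScalarTower F E M := IsScalarTower.of_algebraMap_eq fun x => (i.commutes x).symm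
  AlgEquiv.restrictNormalHom E

lemma resAlong_apply {F E M : Type*} [Field F] [Field E] [Field M] [Algebra F E] [Algebra F M]
    [Normal F E] (i : E →ₐ[F] M) (g : Gal(M/F)) (x : E) : i (resAlong i g x) = g (i x) := by
  let : Algebra E M := i.toRingHom.toAlgebra
  have : IsScalarTower F E M := IsScalarTower.of_algebraMap_eq fun x => (i.commutes x).symm
  exact AlgEquiv.restrictNormal_commutes g E x

lemma resAlong_surjective {F E M : Type*} [Field F] [Field E] [Field M] [Algebra F E] [Algebra F M]
    [Normal F E] [Normal F M] (i : E →ₐ[F] M) : Function.Surjective (resAlong i) := by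
  let : Algebra E M := i.toRingHom.toAlgebra
  have : IsScalarTower F E M := IsScalarTower.of_algebraMap_eq fun x => (i.commutes x).symm
  exact AlgEquiv.restrictNormalHom_surjective M

lemma resAlong_resAlong {F E M L : Type*} [Field F] [Field E] [Field M] [Field L] [Algebra F E]
    [Algebra F M] [Algebra F L] [Normal F E] [Normal F M] (i : E →ₐ[F] M) (j : M →ₐ[F] L)
    (g : Gal(L/F)) : resAlong i (resAlong j g) = resAlong (j.comp i) g := by
  ext x
  apply (j.comp i).injective
  exact (congrArg j (resAlong_apply i _ x)).trans
    ((resAlong_apply j g (i x)).trans (resAlong_apply (j.comp i) g x).symm)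

section Field

variable (K : Type*) [Field K] [CharZero K] [IsAlgClosure ℚ K]

/-- The cyclotomic field `ℚ(n) = ℚ(μ_n)` inside the algebraic closure `K` of `ℚ`. -/
def cyc (n : ℕ+) : IntermediateField ℚ K :=
  IntermediateField.adjoin ℚ {x : K | x ^ (n : ℕ) = 1}

/-- Makes sure that `ℚ(n)` is a `ℚ`-algebra as an intermediate field. -/
instance cyc_algebra (n : ℕ+) : Algebra ℚ (cyc K n) := (cyc K n).algebra'

instance cyc_isCyclotomicExtension (n : ℕ+) : IsCyclotomicExtension {(n : ℕ)} ℚ (cyc K n) := by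
  have h := IntermediateField.isCyclotomicExtension_adjoin_of_exists_isPrimitiveRoot
    {(n : ℕ)} ℚ K (by
      rintro m hm -
      obtain rfl : m = n := hm
      have : IsAlgClosed K := IsAlgClosure.isAlgClosed ℚ
      exact HasEnoughRootsOfUnity.exists_primitiveRoot K (n : ℕ))
  have e : {x : K | ∃ m ∈ ({(n : ℕ)} : Set ℕ), m ≠ 0 ∧ x ^ m = 1} = {x : K | x ^ (n : ℕ) = 1} := by
    ext x; simp
  rw [e] at h
  exact h

instance cyc_isGalois (n : ℕ+) : IsGalois ℚ (cyc K n) :=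
  IsCyclotomicExtension.isGalois {(n : ℕ)} ℚ (cyc K n)

/-- `G_n = Gal(ℚ(n)/ℚ)`. -/
abbrev G (n : ℕ+) : Type _ := Gal(cyc K n/ℚ)

/-- The group ring `R_n = ℤ[G_n]`. -/
abbrev Rn (n : ℕ+) : Type _ := MonoidAlgebra ℤ (G K n)

variable {K}

lemma cyc_mono {n m : ℕ+} (h : n ∣ m) : cyc K n ≤ cyc K m := by
  refine IntermediateField.adjoin.mono _ _ _ fun x hx => ?_
  obtain ⟨k, rfl⟩ := h
  have hx : x ^ (n : ℕ) = 1 := hx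
  show x ^ ((n * k : ℕ+) : ℕ) = 1
  rw [PNat.mul_coe, pow_mul, hx, one_pow]

lemma G_comm {n : ℕ+} (a b : G K n) : a * b = b * a :=
  (IsCyclotomicExtension.isMulCommutative {(n : ℕ)} ℚ (cyc K n)).is_comm.comm a b

/-- The restriction map `G_m → G_n` for `n ∣ m`. -/
def res {n m : ℕ+} (h : n ∣ m) : G K m →* G K n :=
  resAlong (IntermediateField.inclusion (cyc_mono h))

lemma res_apply {n m : ℕ+} (h : n ∣ m) (g : G K m) (x : cyc K n) :
    IntermediateField.inclusion (cyc_mono h) (res h g x) =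
      g (IntermediateField.inclusion (cyc_mono h) x) :=
  resAlong_apply _ g x

/-- The restriction map `Gal(K/ℚ) → G_n`. -/
def resK (n : ℕ+) : Gal(K/ℚ) →* G K n := resAlong (cyc K n).val

lemma resK_apply (n : ℕ+) (σ : Gal(K/ℚ)) (x : cyc K n) : ((resK n σ x : cyc K n) : K) = σ x :=
  resAlong_apply (cyc K n).val σ x

lemma val_comp_inclusion {F L : Type*} [Field F] [Field L] [Algebra F L]
    {A B : IntermediateField F L} (h : A ≤ B) :
    B.val.comp (IntermediateField.inclusion h) = A.val :=
  AlgHom.ext fun _ => rfl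

lemma res_resK {n m : ℕ+} (h : n ∣ m) (σ : Gal(K/ℚ)) : res h (resK m σ) = resK n σ := by
  have e := val_comp_inclusion (cyc_mono (K := K) h)
  rw [res, resK, resAlong_resAlong, e, resK]

lemma Rn_comm {n : ℕ+} (a b : Rn K n) : a * b = b * a := by
  induction a using MonoidAlgebra.induction_linear with
  | zero => simp
  | add a a' h h' => rw [add_mul, mul_add, h, h']
  | single g k =>
    induction b using MonoidAlgebra.induction_linear with
    | zero => simp
    | add a a' h h' => rw [add_mul, mul_add, h, h']
    | single g' k' =>
      rw [MonoidAlgebra.single_mul_single, MonoidAlgebra.single_mul_single, G_comm, mul_comm k]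

/-- The transition map `R_m → R_n` for `n ∣ m`, induced by restriction. -/
def resR {n m : ℕ+} (h : n ∣ m) : Rn K m →+* Rn K n := MonoidAlgebra.mapDomainRingHom ℤ (res h)

lemma resR_single {n m : ℕ+} (h : n ∣ m) (g : G K m) (k : ℤ) :
    resR h (MonoidAlgebra.single g k) = MonoidAlgebra.single (res h g) k := by
  simp [resR]

instance : IsGalois ℚ K :=
  have : Algebra.IsAlgebraic ℚ K := IsAlgClosure.isAlgebraic
  have : Normal ℚ K := IsAlgClosure.normal ℚ K
  ⟨⟩

lemma resK_surjective (n : ℕ+) : Function.Surjective (resK (K := K) n) :=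
  resAlong_surjective _

variable (K) in
/-- The inverse limit of the group rings `ℤ[Gal(ℚ(n)/ℚ)]`, as a subring of their product. -/
def limR : Subring (∀ n : ℕ+, Rn K n) where
  carrier := {r | ∀ (n m : ℕ+) (h : n ∣ m), resR h (r m) = r n}
  mul_mem' ha hb n m h := by simp [ha n m h, hb n m h]
  one_mem' n m h := by simp
  add_mem' ha hb n m h := by simp [ha n m h, hb n m h]
  zero_mem' n m h := by simp
  neg_mem' ha n m h := by simp [ha n m h]

variable (K) in
/-- The ring `R = lim ℤ[Gal(ℚ(n)/ℚ)]`. -/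
def R : Type _ := limR K

instance : CommRing (R K) where
  __ := (inferInstance : Ring (limR K))
  mul_comm a b := Subtype.ext (funext fun n => Rn_comm (a.1 n) (b.1 n))

/-- The image in `R` of an element of `Gal(K/ℚ)`. -/
def galR (σ : Gal(K/ℚ)) : R K :=
  ⟨fun n => MonoidAlgebra.single (resK n σ) 1, fun n m h => by
    rw [resR_single, res_resK]⟩

/-- The automorphism of `K` induced by complex conjugation through an embedding `K → ℂ`. -/
def conjK (ι : K →+* ℂ) : Gal(K/ℚ) :=
  resAlong ι.toRatAlgHom (Complex.conjAe.restrictScalars ℚ)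

lemma conjK_apply (ι : K →+* ℂ) (x : K) : ι (conjK ι x) = (starRingEnd ℂ) (ι x) :=
  resAlong_apply ι.toRatAlgHom (Complex.conjAe.restrictScalars ℚ) x

/-- Complex conjugation as an element of `R`. -/
def tau (ι : K →+* ℂ) : R K := galR (conjK ι)

/-- The action of `G_n` on the unit group `ℚ(n)ˣ`, written additively. -/
def actG (n : ℕ+) : G K n →* AddMonoid.End (Additive (cyc K n)ˣ) where
  toFun g := MonoidHom.toAdditive (Units.map (g : cyc K n →* cyc K n))
  map_one' := rfl
  map_mul' _ _ := rfl

/-- The action of `R_n` on the unit group `ℚ(n)ˣ`, written additively: the element `∑ a_g g` sends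
`x` to `∏ g(x) ^ a_g`. -/
def actn (n : ℕ+) : Rn K n →+* AddMonoid.End (Additive (cyc K n)ˣ) :=
  MonoidAlgebra.liftNCRingHom (Int.castRingHom (AddMonoid.End (Additive (cyc K n)ˣ))) (actG n)
    fun k g => Int.cast_commute k (actG n g)

lemma actn_single (n : ℕ+) (g : G K n) (k : ℤ) (x : Additive (cyc K n)ˣ) :
    actn n (MonoidAlgebra.single g k) x = k • actG n g x := by
  have : actn n (MonoidAlgebra.single g k) = (k : AddMonoid.End (Additive (cyc K n)ˣ)) * actG n g := by
    simp [actn]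
  rw [this]
  rfl

lemma actn_add (n : ℕ+) (a b : Rn K n) (x : Additive (cyc K n)ˣ) :
    actn n (a + b) x = actn n a x + actn n b x := by
  rw [map_add]; rfl

variable (K) in
/-- The unit group `ℚᵃᵇˣ` of the union of the fields `ℚ(n)`. -/
def unitsAb : Subgroup Kˣ where
  carrier := {x | ∃ n : ℕ+, (x : K) ∈ cyc K n}
  one_mem' := ⟨1, (cyc K 1).one_mem⟩
  mul_mem' := by
    rintro x y ⟨n, hn⟩ ⟨m, hm⟩
    exact ⟨n * m, (cyc K (n * m)).mul_mem (cyc_mono (dvd_mul_right n m) hn)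
      (cyc_mono (dvd_mul_left m n) hm)⟩
  inv_mem' := by
    rintro x ⟨n, hn⟩
    refine ⟨n, ?_⟩
    rw [Units.val_inv_eq_inv_val]
    exact (cyc K n).inv_mem hn

variable (K) in
/-- The group `ℚᵃᵇˣ`, written additively so that it can be a module. -/
def UAb : Type _ := Additive (unitsAb K)

instance : AddCommGroup (UAb K) := inferInstanceAs (AddCommGroup (Additive (unitsAb K)))

/-- The unit of `K` underlying an element of `ℚᵃᵇˣ`. -/
def UAb.unit (x : UAb K) : Kˣ := (Additive.toMul x : unitsAb K).1

/-- An element of `Kˣ` that lies in `ℚᵃᵇ`, as an element of the additively written `ℚᵃᵇˣ`. -/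
def UAb.mk (x : Kˣ) (h : x ∈ unitsAb K) : UAb K := Additive.ofMul ⟨x, h⟩

lemma UAb.unit_mk (x : Kˣ) (h : x ∈ unitsAb K) : (UAb.mk x h).unit = x := rfl

lemma UAb.unit_mem (x : UAb K) : ∃ n : ℕ+, (x.unit : K) ∈ cyc K n := x.2

lemma UAb.unit_zero : (0 : UAb K).unit = 1 := rfl

lemma UAb.unit_add (x y : UAb K) : (x + y).unit = x.unit * y.unit := rfl

lemma UAb.unit_sub (x y : UAb K) : (x - y).unit = x.unit / y.unit := rfl

lemma UAb.unit_nsmul (n : ℕ) (x : UAb K) : (n • x).unit = x.unit ^ n := rfl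

lemma UAb.unit_zsmul (n : ℤ) (x : UAb K) : (n • x).unit = x.unit ^ n := rfl

lemma UAb.unit_sum {ι : Type*} (s : Finset ι) (x : ι → UAb K) :
    (∑ i ∈ s, x i).unit = ∏ i ∈ s, (x i).unit := by
  classical
  induction s using Finset.induction_on with
  | empty => simp [UAb.unit_zero]
  | insert a s ha ih => rw [Finset.sum_insert ha, Finset.prod_insert ha, UAb.unit_add, ih]

lemma UAb.unit_injective : Function.Injective (UAb.unit (K := K)) := fun _ _ h =>
  Additive.toMul.injective (Subtype.ext h)

/-- The inclusion `ℚ(n)ˣ → ℚᵃᵇˣ`, written additively. -/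
def incl (n : ℕ+) : Additive (cyc K n)ˣ →+ UAb K :=
  MonoidHom.toAdditive ((Units.map (cyc K n).val.toRingHom.toMonoidHom).codRestrict (unitsAb K)
    fun x => ⟨n, (x : cyc K n).2⟩)

lemma incl_coe (n : ℕ+) (x : Additive (cyc K n)ˣ) :
    ((incl n x).unit : K) = ((x.toMul : cyc K n) : K) := rfl

/-- The inclusion `ℚ(n)ˣ → ℚ(m)ˣ` for `n ∣ m`, written additively. -/
def up {n m : ℕ+} (h : n ∣ m) : Additive (cyc K n)ˣ →+ Additive (cyc K m)ˣ :=
  MonoidHom.toAdditive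
    (Units.map (IntermediateField.inclusion (cyc_mono (K := K) h)).toRingHom.toMonoidHom)

lemma up_coe {n m : ℕ+} (h : n ∣ m) (x : Additive (cyc K n)ˣ) :
    ((up h x).toMul : cyc K m) =
      IntermediateField.inclusion (cyc_mono (K := K) h) (x.toMul : cyc K n) := rfl

lemma ext_unitsAb {x y : UAb K} (h : (x.unit : K) = y.unit) :
    x = y :=
  UAb.unit_injective (Units.ext h)

lemma ext_cyc {n : ℕ+} {x y : Additive (cyc K n)ˣ} (h : (x.toMul : cyc K n) = y.toMul) : x = y :=
  Additive.toMul.injective (Units.ext h)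

lemma incl_up {n m : ℕ+} (h : n ∣ m) (x : Additive (cyc K n)ˣ) : incl m (up h x) = incl n x := by
  apply ext_unitsAb
  rw [incl_coe, incl_coe, up_coe, IntermediateField.coe_inclusion]

lemma incl_injective (n : ℕ+) : Function.Injective (incl (K := K) n) := fun x y h => by
  apply ext_cyc
  apply Subtype.ext
  rw [← incl_coe, ← incl_coe, h]

lemma exists_incl_of_mem (n : ℕ+) (x : UAb K) (h : (x.unit : K) ∈ cyc K n) :
    ∃ y, incl n y = x := by
  have h0 : (⟨(x.unit : K), h⟩ : cyc K n) ≠ 0 := fun e =>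
    x.unit.ne_zero (congrArg (fun y : cyc K n => (y : K)) e)
  exact ⟨Additive.ofMul (Units.mk0 _ h0), ext_unitsAb rfl⟩

lemma exists_incl (x : UAb K) : ∃ n y, incl n y = x := by
  obtain ⟨n, hn⟩ := x.unit_mem
  exact ⟨n, exists_incl_of_mem n x hn⟩

lemma exists_incl₂ (x y : UAb K) : ∃ n x' y', incl n x' = x ∧ incl n y' = y := by
  obtain ⟨n, x', rfl⟩ := exists_incl x
  obtain ⟨m, y', rfl⟩ := exists_incl y
  exact ⟨n * m, up (dvd_mul_right n m) x', up (dvd_mul_left m n) y', incl_up _ _, incl_up _ _⟩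

lemma actG_up {n m : ℕ+} (h : n ∣ m) (g : G K m) (x : Additive (cyc K n)ˣ) :
    actG m g (up h x) = up h (actG n (res h g) x) :=
  ext_cyc (res_apply h g _).symm

lemma actn_up {n m : ℕ+} (h : n ∣ m) (s : Rn K m) (x : Additive (cyc K n)ˣ) :
    actn m s (up h x) = up h (actn n (resR h s) x) := by
  induction s using MonoidAlgebra.induction_linear with
  | zero => simp
  | add a b ha hb =>
    rw [map_add (resR h), actn_add, actn_add, ha, hb, map_add]
  | single g k => rw [resR_single, actn_single, actn_single, actG_up, map_zsmul]

lemma incl_actn_congr (r : R K) {n m : ℕ+} {x : Additive (cyc K n)ˣ} {y : Additive (cyc K m)ˣ}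
    (h : incl n x = incl m y) : incl n (actn n (r.1 n) x) = incl m (actn m (r.1 m) y) := by
  have key : ∀ {i j : ℕ+} (d : i ∣ j) (z : Additive (cyc K i)ˣ),
      incl j (actn j (r.1 j) (up d z)) = incl i (actn i (r.1 i) z) := fun {i j} d z => by
    rw [actn_up, r.2 i j d, incl_up]
  have e : up (dvd_mul_right n m) x = up (dvd_mul_left m n) y :=
    incl_injective _ (by rw [incl_up, incl_up, h])
  rw [← key (dvd_mul_right n m) x, e, key]

/-- The action of `R` on `ℚᵃᵇˣ`: an element `x` of `ℚ(n)ˣ` is sent to `x ^ r_n`, where `r_n` is the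
component of `r` in `ℤ[G_n]`; this does not depend on the choice of `n`. -/
def smulAb (r : R K) (x : UAb K) : UAb K :=
  incl (exists_incl x).choose (actn (exists_incl x).choose (r.1 _) (exists_incl x).choose_spec.choose)

lemma smulAb_incl (r : R K) (n : ℕ+) (x : Additive (cyc K n)ˣ) :
    smulAb r (incl n x) = incl n (actn n (r.1 n) x) :=
  incl_actn_congr r (exists_incl (incl n x)).choose_spec.choose_spec

instance : Module (R K) (UAb K) where
  smul := smulAb
  one_smul x := by
    obtain ⟨n, y, rfl⟩ := exists_incl x
    show smulAb _ _ = _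
    rw [smulAb_incl]
    show incl n (actn n 1 y) = _
    rw [map_one]; rfl
  mul_smul a b x := by
    obtain ⟨n, y, rfl⟩ := exists_incl x
    show smulAb _ _ = smulAb _ (smulAb _ _)
    rw [smulAb_incl, smulAb_incl, smulAb_incl]
    show incl n (actn n (a.1 n * b.1 n) y) = _
    rw [map_mul]; rfl
  smul_zero a := by
    show smulAb _ _ = _
    rw [← map_zero (incl (K := K) 1), smulAb_incl, map_zero]
  smul_add a x y := by
    obtain ⟨n, x, y, rfl, rfl⟩ := exists_incl₂ x y
    show smulAb _ _ = smulAb _ _ + smulAb _ _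
    rw [← map_add, smulAb_incl, smulAb_incl, smulAb_incl, map_add, map_add]
  add_smul a b x := by
    obtain ⟨n, y, rfl⟩ := exists_incl x
    show smulAb _ _ = smulAb _ _ + smulAb _ _
    rw [smulAb_incl, smulAb_incl, smulAb_incl]
    show incl n (actn n (a.1 n + b.1 n) y) = _
    rw [actn_add, map_add]
  zero_smul x := by
    obtain ⟨n, y, rfl⟩ := exists_incl x
    show smulAb _ _ = _
    rw [smulAb_incl]
    show incl n (actn n 0 y) = _
    rw [map_zero, ← map_zero (incl (K := K) n)]; rfl

lemma smul_incl (r : R K) (n : ℕ+) (x : Additive (cyc K n)ˣ) :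
    r • incl n x = incl n (actn n (r.1 n) x) :=
  smulAb_incl r n x

lemma galR_smul_coe (σ : Gal(K/ℚ)) (x : UAb K) :
    ((galR σ • x).unit : K) = σ (x.unit : K) := by
  obtain ⟨n, y, rfl⟩ := exists_incl x
  rw [smul_incl]
  show ((incl n (actn n (MonoidAlgebra.single (resK n σ) 1) y)).unit : K) = _
  rw [actn_single, one_smul, incl_coe]
  exact resK_apply n σ _

lemma galR_smul_coe' (σ : Gal(K/ℚ)) (x : UAb K) :
    (galR σ • x).unit = Units.map (σ : K →* K) x.unit :=
  Units.ext (galR_smul_coe σ x)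

variable (K) in
/-- The set `μ_∞^*` of nontrivial roots of unity. -/
abbrev MuStar : Type _ := {ζ : Kˣ // IsOfFinOrder ζ ∧ ζ ≠ 1}

/-- The action of the Galois group on `μ_∞^*`. -/
def galMu (σ : Gal(K/ℚ)) (ζ : MuStar K) : MuStar K :=
  ⟨Units.map (σ : K →* K) ζ.1, MonoidHom.isOfFinOrder _ ζ.2.1, fun h =>
    ζ.2.2 (Units.map_injective (f := (σ : K →* K)) σ.injective (h.trans (map_one _).symm))⟩

variable (K) in
/-- The multiplicative group of Galois equivariant functions `μ_∞^* → Kˣ`. -/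
def FunGrp : Subgroup (MuStar K → Kˣ) where
  carrier := {f | ∀ (σ : Gal(K/ℚ)) (ζ : MuStar K), f (galMu σ ζ) = Units.map (σ : K →* K) (f ζ)}
  one_mem' σ ζ := by simp
  mul_mem' hf hg σ ζ := by simp [hf σ ζ, hg σ ζ]
  inv_mem' hf σ ζ := by simp [hf σ ζ]

variable (K) in
/-- The group `𝓕` of Galois equivariant functions `μ_∞^* → Kˣ`, written additively so that it can be
a module: `f + g` is the pointwise product. -/
def F : Type _ := Additive (FunGrp K)

instance : AddCommGroup (F K) := inferInstanceAs (AddCommGroup (Additive (FunGrp K)))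

/-- The value of an element of `𝓕` at a nontrivial root of unity. -/
def val (f : F K) (ζ : MuStar K) : Kˣ := (Additive.toMul f : FunGrp K).1 ζ

/-- An equivariant function as an element of `𝓕`. -/
def F.mk (f : MuStar K → Kˣ)
    (h : ∀ (σ : Gal(K/ℚ)) (ζ : MuStar K), f (galMu σ ζ) = Units.map (σ : K →* K) (f ζ)) : F K :=
  Additive.ofMul ⟨f, h⟩

lemma val_mk (f : MuStar K → Kˣ) (h) (ζ : MuStar K) : val (F.mk f h) ζ = f ζ := rfl

lemma val_galMu (f : F K) (σ : Gal(K/ℚ)) (ζ : MuStar K) :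
    val f (galMu σ ζ) = Units.map (σ : K →* K) (val f ζ) := f.2 σ ζ

lemma F.ext {f g : F K} (h : ∀ ζ, val f ζ = val g ζ) : f = g :=
  Additive.toMul.injective (Subtype.ext (funext h))

lemma val_add (f g : F K) (ζ : MuStar K) : val (f + g) ζ = val f ζ * val g ζ := rfl

lemma val_zero (ζ : MuStar K) : val (0 : F K) ζ = 1 := rfl

lemma val_mem_cyc (f : F K) (ζ : MuStar K) (n : ℕ+) (h : ζ.1 ^ (n : ℕ) = 1) :
    (val f ζ : K) ∈ cyc K n := by
  rw [← InfiniteGalois.fixedField_fixingSubgroup (cyc K n), IntermediateField.mem_fixedField_iff]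
  intro σ hσ
  have h1 : galMu σ ζ = ζ := by
    refine Subtype.ext (Units.ext ?_)
    refine (IntermediateField.mem_fixingSubgroup_iff _ _).1 hσ _ ?_
    refine IntermediateField.subset_adjoin _ _ ?_
    show (ζ.1 : K) ^ (n : ℕ) = 1
    rw [← Units.val_pow_eq_pow_val, h, Units.val_one]
  have h2 := val_galMu f σ ζ
  rw [h1] at h2
  exact (congrArg (fun u : Kˣ => (u : K)) h2).symm

lemma val_mem_unitsAb (f : F K) (ζ : MuStar K) : val f ζ ∈ unitsAb K := by
  obtain ⟨n, hn, h⟩ := ζ.2.1.exists_pow_eq_one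
  exact ⟨⟨n, hn⟩, val_mem_cyc f ζ ⟨n, hn⟩ h⟩

/-- The value of an element of `𝓕`, as an element of `ℚᵃᵇˣ`. -/
def valAb : F K →+ (MuStar K → UAb K) where
  toFun f ζ := UAb.mk (val f ζ) (val_mem_unitsAb f ζ)
  map_zero' := rfl
  map_add' _ _ := rfl

lemma unit_valAb (f : F K) (ζ : MuStar K) : (valAb f ζ).unit = val f ζ := rfl

lemma valAb_injective : Function.Injective (valAb (K := K)) := fun _ _ h =>
  F.ext fun ζ => congrArg UAb.unit (congrFun h ζ)

lemma valAb_galMu (f : F K) (σ : Gal(K/ℚ)) (ζ : MuStar K) :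
    valAb f (galMu σ ζ) = galR σ • valAb f ζ :=
  UAb.unit_injective (by rw [galR_smul_coe', unit_valAb, unit_valAb, val_galMu])

/-- `R` acts on `𝓕` by `f ^ r (ζ) = f(ζ) ^ r`. -/
instance : SMul (R K) (F K) where
  smul r f := F.mk (fun ζ => (r • valAb f ζ).unit) fun σ ζ => by
    rw [valAb_galMu, smul_comm, galR_smul_coe']

lemma valAb_smul (r : R K) (f : F K) : valAb (r • f) = r • valAb f := rfl

instance : Module (R K) (F K) := valAb_injective.module (R K) (valAb (K := K)) valAb_smul

lemma val_smul (r : R K) (f : F K) (ζ : MuStar K) : val (r • f) ζ = (r • valAb f ζ).unit := rfl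

lemma val_galR_smul (σ : Gal(K/ℚ)) (f : F K) (ζ : MuStar K) :
    (val (galR σ • f) ζ : K) = σ (val f ζ) :=
  galR_smul_coe σ _

open scoped Classical in
lemma finite_fiber (a : ℕ) (ha : 0 < a) (ε : MuStar K) :
    {ζ : MuStar K | ζ.1 ^ a = ε.1}.Finite := by
  refine Set.Finite.of_finite_image (f := fun ζ : MuStar K => (ζ.1 : K)) ?_
    fun x _ y _ h => Subtype.ext (Units.ext h)
  refine Set.Finite.subset (Polynomial.nthRoots a (ε.1 : K)).toFinset.finite_toSet ?_
  rintro _ ⟨ζ, hζ, rfl⟩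
  have hζ : ζ.1 ^ a = ε.1 := hζ
  simp only [Finset.mem_coe, Multiset.mem_toFinset, Polynomial.mem_nthRoots ha]
  rw [← hζ, Units.val_pow_eq_pow_val]

variable (K) in
/-- The `R`-module `𝓕ᵈ` of circular distributions: `∏_{ζ ^ a = ε} f(ζ) = f(ε)` for all natural
numbers `a ≥ 1` and all `ε ∈ μ_∞^*`. -/
def Fd : Submodule (R K) (F K) where
  carrier := {f | ∀ a : ℕ, 0 < a → ∀ ε : MuStar K,
    ∏ᶠ ζ ∈ {ζ : MuStar K | ζ.1 ^ a = ε.1}, val f ζ = val f ε}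
  zero_mem' a ha ε := by simp [val_zero]
  add_mem' {f g} hf hg a ha ε := by
    simp only [val_add]
    rw [finprod_mem_mul_distrib (finite_fiber a ha ε), hf a ha ε, hg a ha ε]
  smul_mem' r f hf a ha ε := by
    have h := hf a ha ε
    rw [finprod_mem_eq_finite_toFinset_prod _ (finite_fiber a ha ε)] at h ⊢
    have h' : ∑ ζ ∈ (finite_fiber a ha ε).toFinset, valAb f ζ = valAb f ε :=
      UAb.unit_injective ((UAb.unit_sum _ _).trans h)
    have h2 := congrArg (fun x : UAb K => (r • x).unit) h'
    simp only [Finset.smul_sum, UAb.unit_sum] at h2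
    exact h2

variable (K) in
/-- The elements `u` of `Kˣ` with `u ≡ 1` modulo all primes above `ℓ`: for every prime `P` of the
ring of all algebraic integers of `K` that lies above `ℓ`, the element `u` is a quotient `a / b` of
algebraic integers with `b ∉ P` and `a - b ∈ P`. -/
def oneUnits (ℓ : ℕ) : Subgroup Kˣ where
  carrier := {u | ∀ P : Ideal (integralClosure ℤ K), P.IsPrime → (ℓ : integralClosure ℤ K) ∈ P →
    ∃ a b : integralClosure ℤ K, b ∉ P ∧ a - b ∈ P ∧ (u : K) * b = a}
  one_mem' P hP _ := ⟨1, 1, hP.one_notMem, by simp, by simp⟩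
  mul_mem' {u v} hu hv P hP hl := by
    obtain ⟨a, b, hb, hab, e⟩ := hu P hP hl
    obtain ⟨c, d, hd, hcd, e'⟩ := hv P hP hl
    refine ⟨a * c, b * d, fun h => (hP.mem_or_mem h).elim hb hd, ?_, ?_⟩
    · have : a * c - b * d = a * (c - d) + (a - b) * d := by ring
      rw [this]
      exact P.add_mem (P.mul_mem_left _ hcd) (P.mul_mem_right _ hab)
    · push_cast
      rw [← e, ← e']; ring
  inv_mem' {u} hu P hP hl := by
    obtain ⟨a, b, hb, hab, e⟩ := hu P hP hl
    refine ⟨b, a, fun h => hb ?_, ?_, ?_⟩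
    · have : b = a - (a - b) := by ring
      rw [this]; exact P.sub_mem h hab
    · rw [← neg_sub]; exact P.neg_mem hab
    · rw [← e, ← mul_assoc, ← Units.val_mul]; simp

/-- The congruence `x ≡ y` modulo all primes above `ℓ`, for elements of `Kˣ`, in the multiplicative
sense `x / y ≡ 1`. If `x` and `y` are units at the primes above `ℓ`, as the values `f(ε ζ)` and `f(ζ)`
in the definition of strict distributions are, this says that `x - y` lies in the maximal ideal of the
local ring at every prime above `ℓ`. -/
def CongrMod (ℓ : ℕ) (x y : Kˣ) : Prop := x / y ∈ oneUnits K ℓ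

/-- For `y` a unit at all primes above `ℓ`, the multiplicative congruence `x ≡ y` says that `x - y` lies
in the maximal ideal of the local ring at every prime above `ℓ`. -/
lemma congrMod_iff (ℓ : ℕ) (x y : Kˣ)
    (hy : ∀ P : Ideal (integralClosure ℤ K), P.IsPrime → (ℓ : integralClosure ℤ K) ∈ P →
      ∃ a b : integralClosure ℤ K, a ∉ P ∧ b ∉ P ∧ (y : K) * b = a) :
    CongrMod ℓ x y ↔ ∀ P : Ideal (integralClosure ℤ K), P.IsPrime →
      (ℓ : integralClosure ℤ K) ∈ P →
      ∃ c d : integralClosure ℤ K, c ∈ P ∧ d ∉ P ∧ ((x : K) - y) * d = c := by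
  refine forall_congr' fun P => forall_congr' fun hP => forall_congr' fun hl => ?_
  obtain ⟨r, s, hr, hs, e⟩ := hy P hP hl
  constructor
  · rintro ⟨a, b, hb, hab, e'⟩
    refine ⟨(a - b) * r, b * s, P.mul_mem_right _ hab, fun h => (hP.mem_or_mem h).elim hb hs, ?_⟩
    push_cast
    rw [← e, ← e', Units.val_div_eq_div_val]
    field_simp
  · rintro ⟨c, d, hc, hd, e'⟩
    refine ⟨c * s + r * d, r * d, fun h => (hP.mem_or_mem h).elim hr hd, ?_, ?_⟩
    · rw [add_sub_cancel_right]; exact P.mul_mem_right _ hc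
    · push_cast
      rw [← e, ← e']
      field_simp
      ring

lemma oneUnits_gal (ℓ : ℕ) (σ : Gal(K/ℚ)) {u : Kˣ} (hu : u ∈ oneUnits K ℓ) :
    Units.map (σ : K →* K) u ∈ oneUnits K ℓ := by
  intro P hP hl
  let s : integralClosure ℤ K →+* integralClosure ℤ K :=
    ((σ.restrictScalars ℤ).mapIntegralClosure : integralClosure ℤ K →+* integralClosure ℤ K)
  obtain ⟨a, b, hb, hab, e⟩ := hu (P.comap s) (hP.comap s) (by
    rw [Ideal.mem_comap, map_natCast]; exact hl)
  refine ⟨s a, s b, hb, ?_, ?_⟩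
  · rw [← map_sub]; exact hab
  · exact (map_mul σ (u : K) b).symm.trans (congrArg σ e)

lemma oneUnits_smul (ℓ : ℕ) (r : R K) (x : UAb K) (hx : x.unit ∈ oneUnits K ℓ) :
    (r • x).unit ∈ oneUnits K ℓ := by
  obtain ⟨n, y, rfl⟩ := exists_incl x
  rw [smul_incl]
  generalize r.1 n = s
  induction s using MonoidAlgebra.induction_linear with
  | zero => rw [map_zero]; exact (oneUnits K ℓ).one_mem
  | add a b ha hb => rw [actn_add, map_add]; exact (oneUnits K ℓ).mul_mem ha hb
  | single g k =>
    rw [actn_single, map_zsmul, UAb.unit_zsmul]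
    refine (oneUnits K ℓ).zpow_mem ?_ k
    obtain ⟨σ, rfl⟩ := resK_surjective n g
    have : (incl n (actG n (resK n σ) y)).unit = Units.map (σ : K →* K) (incl n y).unit :=
      Units.ext (resK_apply n σ _)
    rw [this]
    exact oneUnits_gal ℓ σ hx

variable (K) in
/-- The `R`-module `𝓕ˢᵈ` of strict distributions: the distributions with
`f(ε ζ) ≡ f(ζ)` modulo all primes above `ℓ`, for all `n ≥ 1`, all primes `ℓ` coprime to `n`, all
`ε ∈ μ_ℓ` and all `ζ ∈ μ_n^*`. -/
def Fsd : Submodule (R K) (F K) where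
  carrier := {f | f ∈ Fd K ∧ ∀ n : ℕ, 0 < n → ∀ ℓ : ℕ, ℓ.Prime → ℓ.Coprime n →
    ∀ ε : Kˣ, ε ^ ℓ = 1 → ∀ ζ ξ : MuStar K, ζ.1 ^ n = 1 → ξ.1 = ε * ζ.1 →
      CongrMod ℓ (val f ξ) (val f ζ)}
  zero_mem' := ⟨(Fd K).zero_mem, fun _ _ ℓ _ _ _ _ _ _ _ _ => by
    simp [CongrMod, val_zero, (oneUnits K ℓ).one_mem]⟩
  add_mem' {f g} hf hg := ⟨(Fd K).add_mem hf.1 hg.1, fun n hn ℓ hl hc ε hε ζ ξ hζ hξ => by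
    rw [CongrMod, val_add, val_add, mul_div_mul_comm]
    exact (oneUnits K ℓ).mul_mem (hf.2 n hn ℓ hl hc ε hε ζ ξ hζ hξ)
      (hg.2 n hn ℓ hl hc ε hε ζ ξ hζ hξ)⟩
  smul_mem' r f hf := ⟨(Fd K).smul_mem r hf.1, fun n hn ℓ hl hc ε hε ζ ξ hζ hξ => by
    have h := oneUnits_smul ℓ r (valAb f ξ - valAb f ζ) (hf.2 n hn ℓ hl hc ε hε ζ ξ hζ hξ)
    rw [smul_sub] at h
    exact h⟩

variable (K) in
/-- The function `Φ(ζ) = 1 - ζ`. -/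
def Phi : F K :=
  F.mk (fun ζ => Units.mk0 (1 - (ζ.1 : K)) (sub_ne_zero.2 fun h => ζ.2.2 (Units.ext h.symm)))
    fun σ ζ => Units.ext (by simp [galMu])

variable (K) in
/-- The `R`-module `𝓕ᶜ` of cyclotomic distributions, generated by `Φ`. -/
def Fc : Submodule (R K) (F K) := Submodule.span (R K) {Phi K}

lemma Phi_mem_Fd : Phi K ∈ Fd K := by
  intro a ha ε
  have : IsAlgClosed K := IsAlgClosure.isAlgClosed ℚ
  have : NeZero a := ⟨ha.ne'⟩
  obtain ⟨η, hη⟩ := HasEnoughRootsOfUnity.exists_primitiveRoot K a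
  obtain ⟨y, hy⟩ := IsAlgClosed.exists_pow_nat_eq (ε.1 : K) ha
  have hy0 : y ≠ 0 := by
    rintro rfl
    exact ε.1.ne_zero (by rw [← hy, zero_pow ha.ne'])
  rw [finprod_mem_eq_finite_toFinset_prod _ (finite_fiber a ha ε)]
  apply Units.ext
  have key := hη.pow_sub_pow_eq_prod_sub_mul 1 y ha
  rw [one_pow, hy] at key
  refine Eq.trans ?_ key.symm
  rw [← Units.coeHom_apply, map_prod]
  refine Finset.prod_bij (fun ζ _ => (ζ.1 : K) / y) ?_ ?_ ?_ ?_
  · intro ζ hζ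
    have hζ : ζ.1 ^ a = ε.1 := by simpa using hζ
    rw [Polynomial.mem_nthRootsFinset ha, div_pow, hy, ← hζ, Units.val_pow_eq_pow_val]
    exact div_self (pow_ne_zero _ ζ.1.ne_zero)
  · intro ζ _ ξ _ h
    exact Subtype.ext (Units.ext ((div_left_inj' hy0).1 h))
  · intro b hb
    rw [Polynomial.mem_nthRootsFinset ha] at hb
    have hb0 : b ≠ 0 := by rintro rfl; simp [ha.ne'] at hb
    have hu : (Units.mk0 (b * y) (mul_ne_zero hb0 hy0)) ^ a = ε.1 :=
      Units.ext (by simp [mul_pow, hb, hy])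
    refine ⟨⟨Units.mk0 (b * y) (mul_ne_zero hb0 hy0), ?_, ?_⟩, ?_, ?_⟩
    · obtain ⟨n, hn, h⟩ := ε.2.1.exists_pow_eq_one
      exact isOfFinOrder_iff_pow_eq_one.2 ⟨a * n, Nat.mul_pos ha hn, by rw [pow_mul, hu, h]⟩
    · intro h
      rw [h, one_pow] at hu
      exact ε.2.2 hu.symm
    · simpa using hu
    · simp [hy0]
  · intro ζ _
    simp [Phi, val_mk, div_mul_cancel₀ _ hy0]

lemma one_sub_mem_of_pow_eq_one {A : Type*} [CommRing A] (P : Ideal A) [hP : P.IsPrime] {ℓ : ℕ}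
    (hl : ℓ.Prime) (hlP : (ℓ : A) ∈ P) {e : A} (he : e ^ ℓ = 1) : 1 - e ∈ P := by
  have : Fact ℓ.Prime := ⟨hl⟩
  have hl0 : ((ℓ : ℕ) : A ⧸ P) = 0 := by
    rw [← map_natCast (Ideal.Quotient.mk P)]; exact Ideal.Quotient.eq_zero_iff_mem.2 hlP
  have : IsDomain (A ⧸ P) := Ideal.Quotient.isDomain P
  have : CharP (A ⧸ P) ℓ := (CharP.charP_iff_prime_eq_zero hl).2 hl0
  rw [← Ideal.Quotient.eq_zero_iff_mem]
  refine (pow_eq_zero_iff hl.ne_zero).1 ?_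
  rw [map_sub, map_one, sub_pow_char, one_pow, ← map_pow, he, map_one, sub_self]

lemma Phi_mem_Fsd : Phi K ∈ Fsd K := by
  refine ⟨Phi_mem_Fd, fun n hn ℓ hl hc ε hε ζ ξ hζ hξ P hP hlP => ?_⟩
  have int : ∀ (u : Kˣ) (m : ℕ), 0 < m → u ^ m = 1 → IsIntegral ℤ (u : K) := fun u m hm h =>
    IsIntegral.of_pow hm (by rw [← Units.val_pow_eq_pow_val, h]; exact isIntegral_one)
  let e : integralClosure ℤ K := ⟨ε, int ε ℓ hl.pos hε⟩
  let z : integralClosure ℤ K := ⟨ζ.1, int ζ.1 n hn hζ⟩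
  have he : e ^ ℓ = 1 := Subtype.ext (congrArg Units.val hε)
  have hz : z ^ n = 1 := Subtype.ext (congrArg Units.val hζ)
  have hz1 : z - 1 ≠ 0 := fun h => ζ.2.2 (Units.ext (congrArg Subtype.val (sub_eq_zero.1 h)))
  refine ⟨1 - e * z, 1 - z, fun h => ?_, ?_, ?_⟩
  · -- the integer `n` would lie in `P`
    have hs : ∑ i ∈ Finset.range n, z ^ i = 0 := by
      have := geom_sum_mul z n
      rw [hz, sub_self] at this
      exact (mul_eq_zero.1 this).resolve_right hz1
    have hq : Ideal.Quotient.mk P z = 1 := by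
      have := Ideal.Quotient.eq_zero_iff_mem.2 h
      rw [map_sub, map_one, sub_eq_zero] at this
      exact this.symm
    have hn' : (n : integralClosure ℤ K) ∈ P := by
      rw [← Ideal.Quotient.eq_zero_iff_mem, map_natCast]
      have := congrArg (Ideal.Quotient.mk P) hs
      simpa [hq] using this
    obtain ⟨x, y, hxy⟩ := Nat.isCoprime_iff_coprime.2 hc
    apply hP.one_notMem
    have : (1 : integralClosure ℤ K) = x * ℓ + y * n := by exact_mod_cast hxy.symm
    rw [this]
    exact P.add_mem (P.mul_mem_left _ hlP) (P.mul_mem_left _ hn')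
  · have : 1 - e * z - (1 - z) = z * (1 - e) := by ring
    rw [this]
    refine P.mul_mem_left _ ?_
    exact one_sub_mem_of_pow_eq_one P hl hlP he
  · have h0 : (1 : K) - ζ.1 ≠ 0 := sub_ne_zero.2 fun h => ζ.2.2 (Units.ext h.symm)
    simp [Phi, val_mk, hξ, e, z, h0]

lemma Fc_le_Fsd : Fc K ≤ Fsd K := (Submodule.span_singleton_le_iff_mem _ _).2 Phi_mem_Fsd

lemma Fsd_le_Fd : Fsd K ≤ Fd K := fun _ h => h.1

/-- The elements of finite order in an `A`-module `M`, as an `A`-submodule. -/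
def tor (A M : Type*) [CommRing A] [AddCommGroup M] [Module A M] : Submodule A M where
  carrier := {x | IsOfFinAddOrder x}
  zero_mem' := IsOfFinAddOrder.zero
  add_mem' hx hy := hx.add hy
  smul_mem' a _ hx := AddMonoidHom.isOfFinAddOrder (DistribSMul.toAddMonoidHom M a) hx

variable (K) in
/-- The torsion submodule `𝓕ᵈ_tor` of `𝓕ᵈ`. -/
def FdTor : Submodule (R K) (F K) := (tor (R K) (Fd K)).map (Fd K).subtype

variable (K) in
/-- The submodule `𝓕ᵈ_tv` of torsion-valued distributions. -/
def FdTv : Submodule (R K) (F K) where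
  carrier := {f | f ∈ Fd K ∧ ∀ ζ : MuStar K, IsOfFinOrder (val f ζ)}
  zero_mem' := ⟨(Fd K).zero_mem, fun _ => IsOfFinOrder.one⟩
  add_mem' hf hg := ⟨(Fd K).add_mem hf.1 hg.1, fun ζ => (hf.2 ζ).mul (hg.2 ζ)⟩
  smul_mem' r f hf := ⟨(Fd K).smul_mem r hf.1, fun ζ => by
    obtain ⟨n, hn, h⟩ := (hf.2 ζ).exists_pow_eq_one
    have h1 : n • valAb f ζ = 0 := UAb.unit_injective h
    refine isOfFinOrder_iff_pow_eq_one.2 ⟨n, hn, ?_⟩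
    rw [val_smul, ← UAb.unit_nsmul, smul_comm, h1, smul_zero, UAb.unit_zero]⟩

variable (K) in
/-- The group `lim μ_m`, as a subgroup of a product, where `μ_{km} → μ_m` is `x ↦ x ^ k`. -/
def ZHatGrp : Subgroup (ℕ+ → Kˣ) where
  carrier := {x | (∀ m : ℕ+, x m ^ (m : ℕ) = 1) ∧ ∀ m k : ℕ+, x (k * m) ^ (k : ℕ) = x m}
  one_mem' := by simp
  mul_mem' hx hy := ⟨fun m => by simp [mul_pow, hx.1 m, hy.1 m], fun m k => by
    simp [mul_pow, hx.2 m k, hy.2 m k]⟩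
  inv_mem' hx := ⟨fun m => by simp [hx.1 m], fun m k => by simp [hx.2 m k]⟩

variable (K) in
/-- The group `Ẑ(1) = lim μ_m`, written additively. -/
def ZHat1 : Type _ := Additive (ZHatGrp K)

instance : AddCommGroup (ZHat1 K) := inferInstanceAs (AddCommGroup (Additive (ZHatGrp K)))

/-- The component in `μ_m` of an element of `lim μ_m`. -/
def comp (x : ZHat1 K) (m : ℕ+) : Kˣ := (Additive.toMul x : ZHatGrp K).1 m

/-- A compatible family of roots of unity as an element of `lim μ_m`. -/
def ZHat1.mk (x : ℕ+ → Kˣ) (h : ∀ m : ℕ+, x m ^ (m : ℕ) = 1)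
    (h' : ∀ m k : ℕ+, x (k * m) ^ (k : ℕ) = x m) : ZHat1 K :=
  Additive.ofMul ⟨x, h, h'⟩

lemma comp_pow (x : ZHat1 K) (m : ℕ+) : comp x m ^ (m : ℕ) = 1 := x.2.1 m

lemma comp_mul_pow (x : ZHat1 K) (m k : ℕ+) : comp x (k * m) ^ (k : ℕ) = comp x m := x.2.2 m k

lemma ZHat1.ext {x y : ZHat1 K} (h : ∀ m, comp x m = comp y m) : x = y :=
  Additive.toMul.injective (Subtype.ext (funext h))

lemma comp_mem_unitsAb (x : ZHat1 K) (m : ℕ+) : comp x m ∈ unitsAb K := by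
  refine ⟨m, IntermediateField.subset_adjoin _ _ ?_⟩
  show (comp x m : K) ^ (m : ℕ) = 1
  rw [← Units.val_pow_eq_pow_val, comp_pow, Units.val_one]

/-- The components of an element of `lim μ_m`, as elements of `ℚᵃᵇˣ`. -/
def compAb : ZHat1 K →+ (ℕ+ → UAb K) where
  toFun x m := UAb.mk (comp x m) (comp_mem_unitsAb x m)
  map_zero' := rfl
  map_add' _ _ := rfl

lemma compAb_injective : Function.Injective (compAb (K := K)) := fun _ _ h =>
  ZHat1.ext fun m => congrArg UAb.unit (congrFun h m)

lemma compAb_nsmul (x : ZHat1 K) (m : ℕ+) : (m : ℕ) • compAb x m = 0 :=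
  UAb.unit_injective (comp_pow x m)

lemma compAb_mul_nsmul (x : ZHat1 K) (m k : ℕ+) : (k : ℕ) • compAb x (k * m) = compAb x m :=
  UAb.unit_injective (comp_mul_pow x m k)

/-- `R` acts on `lim μ_m` componentwise. -/
instance : SMul (R K) (ZHat1 K) where
  smul r x := ZHat1.mk (fun m => (r • compAb x m).unit)
    (fun m => by rw [← UAb.unit_nsmul, smul_comm, compAb_nsmul, smul_zero, UAb.unit_zero])
    (fun m k => by rw [← UAb.unit_nsmul, smul_comm, compAb_mul_nsmul])

lemma compAb_smul (r : R K) (x : ZHat1 K) : compAb (r • x) = r • compAb x := rfl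

instance : Module (R K) (ZHat1 K) := compAb_injective.module (R K) (compAb (K := K)) compAb_smul

end Field

end CircDist

end

/-!
Functions in `𝓕` are written additively, so `f + g` is a pointwise product and `r • f` is `f ^ r`.

**The kernel of `1 + τ`.** Complex conjugation inverts roots of unity, so `1 + τ` kills
torsion-valued distributions. Conversely, let `f` be a distribution killed by `1 + τ`. Then every
conjugate of every value of `f` has absolute value `1`, and by Kronecker's theorem a value has
finite order as soon as it is an algebraic integer. Let `ε` have order `n` and let `ℓ` be a prime
factor of `n`. The distribution relation for `ℓ ^ k` says that `f(ε)` is a norm from `ℚ(n ℓ ^ k)` to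
`ℚ(n)` (`norm_valCyc`). At a prime `v` not above `ℓ` the valuation of a norm is divisible by the
residue degree, which is unbounded in `k` because the residue field contains the `ℓ ^ k`-th roots of
unity; hence `v(f(ε)) = 0` (`valuation_valCyc_eq_one`). If `n` has two prime factors this covers all
`v`. If `n` is a prime power, the distribution relation for an exponent `a ≡ -1` modulo `n`
expresses `f(ε)` as `f(ε⁻¹) = f(ε)⁻¹` times values at roots of unity whose orders have two prime
factors, so `f(ε) ^ 2` has finite order (`isOfFinOrder_val`).

**Torsion-valued distributions.** The generator of `(1 - τ) 𝓕ᶜ` is `Φ^{1-τ}(ζ) = -ζ`. Let `f` be a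
torsion-valued distribution. If `4 ∣ n`, then `-ζ` generates the roots of unity of `ℚ(n)` for every
`ζ` of order `n`, so `f(ζ) = (-ζ) ^ c(n)` with `c(n)` in `ℤ/n`. The distribution relations make the
`c(n)` compatible (`exponent_dvd_sub`): this is immediate for a prime that divides `n`, while for a
prime `p ∤ n` they only give `(p - 1) c(p n) ≡ (p - 1) c(n)`, and an induction removes the factor
`p - 1` by passing to level `(p - 1) n`. A compatible family of exponents is realised by an element `r`
of `R` (`exists_smul_eq_zsmul`), because along even levels `n ∣ m` the number `n` is the exponent of
an element of the kernel of `ℤ[G_m] → ℤ[G_n]`. Then `f - r • Φ^{1-τ}` is trivial on the roots of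
unity of order divisible by `4`, which forces its square to be trivial (`val_sq_eq_one`).

**The isomorphisms.** An element `r` of `R` kills `Φ^{1-τ}` if and only if it kills all roots of
unity, if and only if it kills a generator of `Ẑ(1)`; the group of roots of unity is divisible, so
`(1 - τ) 𝓕ᶜ` is torsion-free. Since `exists_smul_eq_zsmul` also shows that `Ẑ(1)` is a cyclic
`R`-module, the isomorphisms follow. The last claim is formal: if `(1 + τ) f = (1 + τ) x` with `x`
in `𝓕ᶜ`, then `f - x` is torsion-valued and therefore lies in `𝓕ᵈ_tor + 𝓕ᶜ`.
-/

namespace CircDist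

/-! ### Valuations of norms -/

section NormValuation

open IsDedekindDomain Ideal NumberField
open scoped WithZero

variable {E L : Type*} [Field E] [Field L] [NumberField E] [NumberField L] [Algebra E L]

/-- If all primes above `v` have residue degree `d` over `v`, then the exponent of `v` in the norm
of an ideal is divisible by `d`, because the norm of a prime `P` above `v` is `v ^ d`. -/
lemma dvd_count_relNorm (v : HeightOneSpectrum (𝓞 E)) (d : ℕ)
    (hd : ∀ P : Ideal (𝓞 L), P.IsPrime → P.LiesOver v.asIdeal → P.inertiaDeg (𝓞 E) = d)
    (I : Ideal (𝓞 L)) (hI : I ≠ 0) :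
    d ∣ (Associates.mk v.asIdeal).count (Associates.mk (relNorm (𝓞 E) I)).factors := by
  have hirr := v.associates_irreducible
  induction I using UniqueFactorizationMonoid.induction_on_prime with
  | h₁ => exact absurd rfl hI
  | h₂ I hu =>
    rw [Ideal.isUnit_iff] at hu
    rw [hu, relNorm_top, ← one_eq_top, Associates.mk_one, Associates.factors_one,
      Associates.count_zero hirr]
    exact dvd_zero d
  | h₃ I P hI0 hP ih =>
    have hP0 : P ≠ 0 := hP.ne_zero
    have : P.IsPrime := isPrime_of_prime hP
    have : P.IsMaximal := Ring.DimensionLEOne.maximalOfPrime hP0 this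
    have hn : ∀ J : Ideal (𝓞 L), J ≠ 0 → Associates.mk (relNorm (𝓞 E) J) ≠ 0 := fun J hJ h =>
      hJ (relNorm_eq_bot_iff.1 (Associates.mk_eq_zero.1 h))
    rw [map_mul, ← Associates.mk_mul_mk, Associates.count_mul (hn P hP0) (hn I hI0) hirr]
    refine dvd_add ?_ (ih hI0)
    have hu0 : P.under (𝓞 E) ≠ ⊥ := fun h => hP0 (Ideal.eq_bot_of_comap_eq_bot h)
    have : (P.under (𝓞 E)).IsMaximal :=
      Ring.DimensionLEOne.maximalOfPrime hu0 (IsPrime.under (𝓞 E) P)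
    rw [relNorm_eq_pow_of_isMaximal P (P.under (𝓞 E)), Associates.mk_pow,
      Associates.count_pow (by simpa using hu0) hirr]
    by_cases h : P.under (𝓞 E) = v.asIdeal
    · rw [hd P inferInstance ⟨h.symm⟩]
      exact dvd_mul_right d _
    · rw [Associates.count_eq_zero_of_ne hirr
        (Associates.irreducible_mk.2 (prime_of_isPrime hu0 inferInstance).irreducible)
        (fun e => h (associated_iff_eq.1 (Associates.mk_eq_mk_iff_associated.1 e)).symm), mul_zero]
      exact dvd_zero d

/-- If all primes above `v` have residue degree `d` over `v`, then the valuation at `v` of a norm is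
divisible by `d`. -/
lemma exists_valuation_norm_eq (v : HeightOneSpectrum (𝓞 E)) (d : ℕ)
    (hd : ∀ P : Ideal (𝓞 L), P.IsPrime → P.LiesOver v.asIdeal → P.inertiaDeg (𝓞 E) = d)
    (x : L) (hx : x ≠ 0) :
    ∃ k : ℤ, v.valuation E (Algebra.norm E x) = WithZero.exp (d * k) := by
  have key : ∀ a : 𝓞 L, a ≠ 0 →
      ∃ k : ℤ, v.valuation E (Algebra.norm E (algebraMap (𝓞 L) L a)) = WithZero.exp (d * k) := by
    intro a ha
    obtain ⟨k, hk⟩ := dvd_count_relNorm v d hd (span {a}) (by simpa using ha)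
    refine ⟨-k, ?_⟩
    have h0 : Algebra.intNorm (𝓞 E) (𝓞 L) a ≠ 0 := by
      rwa [Ne, Algebra.intNorm_eq_zero]
    rw [← Algebra.algebraMap_intNorm (A := 𝓞 E), HeightOneSpectrum.valuation_of_algebraMap,
      HeightOneSpectrum.intValuation_if_neg _ h0, ← relNorm_singleton, hk]
    push_cast
    rw [mul_neg]
  obtain ⟨a, b, hb, rfl⟩ := IsFractionRing.div_surjective (A := 𝓞 L) x
  have hb0 : b ≠ 0 := nonZeroDivisors.ne_zero hb
  have ha0 : a ≠ 0 := by rintro rfl; simp at hx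
  obtain ⟨k, hk⟩ := key a ha0
  obtain ⟨l, hl⟩ := key b hb0
  refine ⟨k - l, ?_⟩
  have hb1 : algebraMap (𝓞 L) L b ≠ 0 := by simpa using hb0
  have h := congrArg (fun y => v.valuation E (Algebra.norm E y))
    (div_mul_cancel₀ (algebraMap (𝓞 L) L a) hb1)
  simp only [map_mul, hk, hl] at h
  rw [mul_sub, WithZero.exp_sub, eq_div_iff WithZero.coe_ne_zero, h]

/-- Roots of unity of order prime to `P` remain distinct modulo `P`. -/
lemma le_absNorm_of_isPrimitiveRoot {q : ℕ} (hq : 0 < q) {ω : L} (hω : IsPrimitiveRoot ω q)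
    (P : Ideal (𝓞 L)) [hP : P.IsPrime] (hP0 : P ≠ ⊥) (hqP : (q : 𝓞 L) ∉ P) :
    q ≤ absNorm P := by
  have : NeZero q := ⟨hq.ne'⟩
  have : IsDomain (𝓞 L ⧸ P) := Ideal.Quotient.isDomain P
  have hf : Finite (𝓞 L ⧸ P) := Ideal.finiteQuotientOfFreeOfNeBot P hP0
  have : NeZero ((q : ℕ) : 𝓞 L ⧸ P) := ⟨fun h => hqP (by
    rwa [← map_natCast (Ideal.Quotient.mk P), Ideal.Quotient.eq_zero_iff_mem] at h)⟩
  have h1 : IsPrimitiveRoot hω.toInteger q := hω.toInteger_isPrimitiveRoot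
  have h2 : IsPrimitiveRoot (Ideal.Quotient.mk P hω.toInteger) q := by
    rw [← Polynomial.isRoot_cyclotomic_iff, ← Polynomial.map_cyclotomic q (Ideal.Quotient.mk P)]
    exact ((Polynomial.isRoot_cyclotomic_iff_charZero hq).2 h1).map
  have h3 : Function.Injective fun i : Fin q => (Ideal.Quotient.mk P hω.toInteger) ^ (i : ℕ) :=
    fun i j h => Fin.ext (h2.pow_inj i.2 j.2 h)
  have h4 := Nat.card_le_card_of_injective _ h3
  rwa [Nat.card_fin] at h4

/-- In a Galois extension `L/E` that contains the `q`-th roots of unity, the valuation of a norm at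
a prime `v ∤ q` is divisible by the common residue degree `d`, which is large when `q` is. -/
lemma exists_valuation_norm_eq_of_isPrimitiveRoot [IsGalois E L] (v : HeightOneSpectrum (𝓞 E))
    {q : ℕ} (hq : 0 < q) (hqv : (q : 𝓞 E) ∉ v.asIdeal) {ω : L}
    (hω : IsPrimitiveRoot ω q) (x : L) (hx : x ≠ 0) :
    ∃ (d : ℕ) (k : ℤ), q ≤ absNorm v.asIdeal ^ d ∧
      v.valuation E (Algebra.norm E x) = WithZero.exp (d * k) := by
  obtain ⟨⟨P, hP, hPv⟩⟩ := (inferInstance : Nonempty (primesOver v.asIdeal (𝓞 L)))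
  have hP0 : P ≠ ⊥ := fun h => v.ne_bot (by
    rw [hPv.over, h]
    exact Ideal.comap_bot_of_injective _ (FaithfulSMul.algebraMap_injective _ _))
  refine ⟨P.inertiaDeg (𝓞 E), ?_⟩
  obtain ⟨k, hk⟩ := exists_valuation_norm_eq v (P.inertiaDeg (𝓞 E)) (fun Q hQ hQv =>
    inertiaDeg_eq_of_isGaloisGroup v.asIdeal Q P Gal(L/E)) x hx
  refine ⟨k, ?_, hk⟩
  rw [absNorm_pow_inertiaDeg v.asIdeal P]
  refine le_absNorm_of_isPrimitiveRoot hq hω P hP0 fun h => hqv ?_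
  rw [hPv.over, Ideal.mem_comap, map_natCast]
  exact h

end NormValuation

/-! ### Roots of unity and the Galois action on them -/

/-- If every prime factor of `a` divides the order of `ζ ^ a`, then the order of `ζ` is as large as
possible. -/
lemma isPrimitiveRoot_of_pow {M : Type*} [CommMonoid M] {ζ : M} {n a : ℕ}
    (ha : 0 < a) (h : IsPrimitiveRoot (ζ ^ a) n) (hp : ∀ p : ℕ, p.Prime → p ∣ a → p ∣ n) :
    IsPrimitiveRoot ζ (n * a) := by
  have hord := h.eq_orderOf
  rw [orderOf_pow' ζ ha.ne'] at hord
  obtain ⟨b, hb⟩ := Nat.gcd_dvd_right (orderOf ζ) a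
  have hN : orderOf ζ = n * (orderOf ζ).gcd a := by
    rw [hord]; exact (Nat.div_mul_cancel (Nat.gcd_dvd_left _ _)).symm
  have hd : 0 < (orderOf ζ).gcd a := Nat.gcd_pos_of_pos_right _ ha
  have hb1 : b = 1 := by
    by_contra hb1
    obtain ⟨p, hpp, hpb⟩ := Nat.exists_prime_and_dvd hb1
    have hpa : (orderOf ζ).gcd a * p ∣ a := by
      conv_rhs => rw [hb]
      exact Nat.mul_dvd_mul_left _ hpb
    have hpN : (orderOf ζ).gcd a * p ∣ orderOf ζ := by
      conv_rhs => rw [hN, mul_comm]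
      exact Nat.mul_dvd_mul_left _ (hp p hpp ((dvd_mul_left _ _).trans hpa))
    have := Nat.le_of_dvd hd (Nat.dvd_gcd hpN hpa)
    have := hpp.two_le
    nlinarith
  rw [hb1, mul_one] at hb
  rw [← hb] at hN
  rw [← hN]
  exact IsPrimitiveRoot.orderOf ζ

variable {K : Type*} [Field K] [CharZero K] [IsAlgClosure ℚ K]

variable (K) in
lemma exists_isPrimitiveRoot (n : ℕ) (hn : 0 < n) : ∃ ζ : Kˣ, IsPrimitiveRoot ζ n := by
  have : IsAlgClosed K := IsAlgClosure.isAlgClosed ℚ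
  have : NeZero n := ⟨hn.ne'⟩
  obtain ⟨η, hη⟩ := HasEnoughRootsOfUnity.exists_primitiveRoot K n
  exact ⟨_, hη.isUnit_unit hn.ne'⟩

lemma exists_unit_pow_eq (x : Kˣ) (a : ℕ) (ha : 0 < a) : ∃ y : Kˣ, y ^ a = x := by
  have : IsAlgClosed K := IsAlgClosure.isAlgClosed ℚ
  obtain ⟨y, hy⟩ := IsAlgClosed.exists_pow_nat_eq (x : K) ha
  have hy0 : y ≠ 0 := by
    rintro rfl
    exact x.ne_zero (by rw [← hy, zero_pow ha.ne'])
  exact ⟨Units.mk0 y hy0, Units.ext (by simpa using hy)⟩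

lemma mem_cyc_of_pow_eq_one (n : ℕ+) (x : K) (h : x ^ (n : ℕ) = 1) : x ∈ cyc K n :=
  IntermediateField.subset_adjoin _ _ h

lemma exists_pow_eq_of_isPrimitiveRoot {n : ℕ} (hn : 0 < n) {ζ x : Kˣ} (hζ : IsPrimitiveRoot ζ n)
    (hx : x ^ n = 1) : ∃ i : ℕ, x = ζ ^ i := by
  have : NeZero n := ⟨hn.ne'⟩
  obtain ⟨i, -, hi⟩ := (IsPrimitiveRoot.coe_units_iff.2 hζ).eq_pow_of_pow_eq_one
    (ξ := (x : K)) (by rw [← Units.val_pow_eq_pow_val, hx, Units.val_one])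
  exact ⟨i, Units.ext (by rw [← hi, Units.val_pow_eq_pow_val])⟩

/-- For `a` coprime to `n`, some automorphism raises all `n`-th roots of unity to the power `a`. -/
lemma exists_gal_pow (n : ℕ+) (a : ℕ) (ha : a.Coprime n) :
    ∃ σ : Gal(K/ℚ), ∀ x : Kˣ, x ^ (n : ℕ) = 1 → Units.map (σ : K →* K) x = x ^ a := by
  have hirr := Polynomial.cyclotomic.irreducible_rat n.pos
  have hζ' := IsCyclotomicExtension.zeta_spec (n : ℕ) ℚ (cyc K n)
  have hζK : IsPrimitiveRoot ((IsCyclotomicExtension.zeta n ℚ (cyc K n) : cyc K n) : K) n :=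
    hζ'.map_of_injective (f := (cyc K n).val) (cyc K n).val.injective
  obtain ⟨σ, hσ⟩ := resK_surjective n
    (IsCyclotomicExtension.fromZetaAut (hζ'.pow_of_coprime a ha) hirr)
  have hζ := hζK.isUnit_unit n.ne_zero
  have key : Units.map (σ : K →* K) (hζK.isUnit n.ne_zero).unit =
      (hζK.isUnit n.ne_zero).unit ^ a := by
    apply Units.ext
    have h1 := resK_apply n σ (IsCyclotomicExtension.zeta n ℚ (cyc K n))
    rw [hσ, IsCyclotomicExtension.fromZetaAut_spec] at h1
    exact h1.symm
  refine ⟨σ, fun x hx => ?_⟩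
  obtain ⟨i, rfl⟩ := exists_pow_eq_of_isPrimitiveRoot n.pos hζ hx
  rw [map_pow, key, ← pow_mul, ← pow_mul, mul_comm]

/-- Every automorphism raises all `n`-th roots of unity to one and the same power. -/
lemma gal_pow (n : ℕ+) (σ : Gal(K/ℚ)) :
    ∃ a : ℕ, ∀ x : Kˣ, x ^ (n : ℕ) = 1 → Units.map (σ : K →* K) x = x ^ a := by
  obtain ⟨ζ, hζ⟩ := exists_isPrimitiveRoot K n n.pos
  obtain ⟨a, ha⟩ := exists_pow_eq_of_isPrimitiveRoot n.pos hζ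
    (x := Units.map (σ : K →* K) ζ) (by rw [← map_pow, hζ.pow_eq_one, map_one])
  refine ⟨a, fun x hx => ?_⟩
  obtain ⟨i, rfl⟩ := exists_pow_eq_of_isPrimitiveRoot n.pos hζ hx
  rw [map_pow, ha, ← pow_mul, ← pow_mul, mul_comm]

lemma exists_gal_map_eq {n : ℕ} (hn : 0 < n) {ζ ξ : Kˣ} (hζ : IsPrimitiveRoot ζ n)
    (hξ : IsPrimitiveRoot ξ n) : ∃ σ : Gal(K/ℚ), Units.map (σ : K →* K) ζ = ξ := by
  obtain ⟨a, rfl⟩ := exists_pow_eq_of_isPrimitiveRoot hn hζ hξ.pow_eq_one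
  obtain ⟨σ, hσ⟩ := exists_gal_pow (K := K) ⟨n, hn⟩ a ((hζ.pow_iff_coprime hn a).1 hξ)
  exact ⟨σ, hσ ζ hζ.pow_eq_one⟩

lemma adjoin_eq_cyc (n : ℕ+) {ζ : Kˣ} (hζ : IsPrimitiveRoot ζ (n : ℕ)) :
    IntermediateField.adjoin ℚ {(ζ : K)} = cyc K n := by
  apply le_antisymm
  · rw [IntermediateField.adjoin_simple_le_iff]
    exact mem_cyc_of_pow_eq_one n _ (IsPrimitiveRoot.coe_units_iff.2 hζ).pow_eq_one
  · refine IntermediateField.adjoin_le_iff.2 fun x hx => ?_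
    obtain ⟨i, -, rfl⟩ := (IsPrimitiveRoot.coe_units_iff.2 hζ).eq_pow_of_pow_eq_one hx
    exact pow_mem (IntermediateField.mem_adjoin_simple_self ℚ _) i

lemma gal_eq_on_cyc (n : ℕ+) {σ ρ : Gal(K/ℚ)} {ζ : Kˣ} (hζ : IsPrimitiveRoot ζ (n : ℕ))
    (h : σ (ζ : K) = ρ ζ) (x : K) (hx : x ∈ cyc K n) : σ x = ρ x := by
  rw [← adjoin_eq_cyc n hζ] at hx
  induction hx using IntermediateField.adjoin_induction with
  | mem y hy => obtain rfl := hy; exact h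
  | algebraMap q => rw [AlgEquiv.commutes, AlgEquiv.commutes]
  | add y z _ _ hy hz => rw [map_add, map_add, hy, hz]
  | inv y _ hy => rw [map_inv₀, map_inv₀, hy]
  | mul y z _ _ hy hz => rw [map_mul, map_mul, hy, hz]

/-- Complex conjugation inverts roots of unity. -/
lemma conjK_map (ι : K →+* ℂ) (x : Kˣ) (hx : IsOfFinOrder x) :
    Units.map (conjK ι : K →* K) x = x⁻¹ := by
  apply Units.ext
  apply ι.injective
  obtain ⟨n, hn, h⟩ := hx.exists_pow_eq_one
  have h1 : ι x ^ n = 1 := by rw [← map_pow, ← Units.val_pow_eq_pow_val, h]; simp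
  have h2 := Complex.norm_eq_one_of_pow_eq_one h1 hn.ne'
  show ι (conjK ι (x : K)) = _
  rw [conjK_apply, Units.val_inv_eq_inv_val, map_inv₀, Complex.inv_eq_conj h2]

/-- For even `n`, every root of unity in `ℚ(n)` is an `n`-th root of unity. -/
lemma pow_eq_one_of_mem_cyc (n : ℕ+) (hn : 2 ∣ (n : ℕ)) {x : Kˣ} (hx : IsOfFinOrder x)
    (h : (x : K) ∈ cyc K n) : x ^ (n : ℕ) = 1 := by
  have h1 : IsPrimitiveRoot (⟨x, h⟩ : cyc K n) (orderOf x) := by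
    refine IsPrimitiveRoot.of_map_of_injective (f := (cyc K n).val) ?_ (cyc K n).val.injective
    exact IsPrimitiveRoot.coe_units_iff.2 (IsPrimitiveRoot.orderOf x)
  have : FiniteDimensional ℚ (cyc K n) := IsCyclotomicExtension.finiteDimensional {(n : ℕ)} ℚ _
  have hl := hx.orderOf_pos
  have hle := h1.lcm_totient_le_finrank (IsCyclotomicExtension.zeta_spec (n : ℕ) ℚ (cyc K n))
    (Polynomial.cyclotomic.irreducible_rat (Nat.lcm_pos hl n.pos))
  rw [IsCyclotomicExtension.finrank (cyc K n) (Polynomial.cyclotomic.irreducible_rat n.pos)] at hle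
  obtain ⟨r, hr⟩ := Nat.dvd_lcm_right (orderOf x) n
  have hφ := Nat.totient_pos.2 n.pos
  -- `φ(n r) ≤ φ(n)` forces `r = 1`, because `φ(2 n) = 2 φ(n)` for even `n`
  have hr1 : r = 1 := by
    have hr0 : 0 < r := Nat.pos_of_ne_zero fun h0 => by
      rw [h0, mul_zero] at hr
      exact (Nat.lcm_pos hl n.pos).ne' hr
    rw [hr] at hle
    have h2 := (Nat.totient_super_multiplicative n r).trans hle
    have h3 : r.totient ≤ 1 := by
      by_contra! h3
      nlinarith
    rcases (Nat.dvd_prime Nat.prime_two).1 (Nat.dvd_two_of_totient_le_one hr0 h3) with h4 | h4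
    · exact h4
    · rw [h4, mul_comm, Nat.totient_two_mul_of_even (even_iff_two_dvd.2 hn)] at hle
      omega
  rw [← orderOf_dvd_iff_pow_eq_one]
  rw [hr1, mul_one] at hr
  exact hr ▸ Nat.dvd_lcm_left _ _

/-! ### Values of distributions are units -/

instance cyc_numberField (n : ℕ+) : NumberField (cyc K n) :=
  IsCyclotomicExtension.numberField {(n : ℕ)} ℚ (cyc K n)

/-- The inclusion `ℚ(n) ⊆ ℚ(m)` for `n ∣ m`, as an algebra structure. -/
abbrev cycAlgebra {n m : ℕ+} (h : n ∣ m) : Algebra (cyc K n) (cyc K m) :=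
  (IntermediateField.inclusion (cyc_mono (K := K) h)).toRingHom.toAlgebra

lemma cycAlgebra_isGalois {n m : ℕ+} (h : n ∣ m) :
    letI := cycAlgebra (K := K) h
    IsGalois (cyc K n) (cyc K m) := by
  let := cycAlgebra (K := K) h
  have : IsScalarTower ℚ (cyc K n) (cyc K m) := IsScalarTower.of_algebraMap_eq fun x => rfl
  exact IsGalois.tower_top_of_isGalois ℚ (cyc K n) (cyc K m)

/-- The value `f(ζ)`, as an element of `ℚ(n)`. -/
def valCyc (f : F K) (ζ : MuStar K) (n : ℕ+) (h : ζ.1 ^ (n : ℕ) = 1) : cyc K n :=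
  ⟨val f ζ, val_mem_cyc f ζ n h⟩

lemma valCyc_ne_zero (f : F K) (ζ : MuStar K) (n : ℕ+) (h : ζ.1 ^ (n : ℕ) = 1) :
    valCyc f ζ n h ≠ 0 := fun h0 => (val f ζ).ne_zero (congrArg Subtype.val h0)

/-- If all `a`-th roots of `ε` have the same order, then the distribution relation is a norm
relation. -/
lemma norm_valCyc {f : F K} (hf : f ∈ Fd K) {n m : ℕ+} (h : n ∣ m) {a : ℕ} (ha : 0 < a)
    {ε ξ : MuStar K} (hε : IsPrimitiveRoot ε.1 n) (hξ : ξ.1 ^ a = ε.1)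
    (hm : ∀ ζ : MuStar K, ζ.1 ^ a = ε.1 → IsPrimitiveRoot ζ.1 m) :
    letI := cycAlgebra (K := K) h
    Algebra.norm (cyc K n) (valCyc f ξ m (hm ξ hξ).pow_eq_one) =
      valCyc f ε n hε.pow_eq_one := by
  let := cycAlgebra (K := K) h
  have := cycAlgebra_isGalois (K := K) h
  have : IsScalarTower ℚ (cyc K n) (cyc K m) := IsScalarTower.of_algebraMap_eq fun x => rfl
  have : FiniteDimensional (cyc K n) (cyc K m) := FiniteDimensional.right ℚ _ _
  have hval : ∀ x : cyc K n, ((algebraMap (cyc K n) (cyc K m) x : cyc K m) : K) = x := fun x => rfl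
  apply Subtype.ext
  rw [← hval, Algebra.norm_eq_prod_automorphisms]
  have hfd := hf a ha ε
  rw [finprod_mem_eq_finite_toFinset_prod _ (finite_fiber a ha ε)] at hfd
  refine Eq.trans ?_ (congrArg Units.val hfd)
  rw [← Units.coeHom_apply, map_prod]
  rw [show ∀ x : cyc K m, (x : K) = (cyc K m).val x from fun x => rfl, map_prod]
  -- lifts to `K` of the automorphisms of `ℚ(m)` over `ℚ(n)`
  choose s hs using fun σ : Gal(cyc K m/cyc K n) => resK_surjective m (σ.restrictScalars ℚ)
  have hs' : ∀ σ (x : cyc K m), s σ (x : K) = (σ x : cyc K m) := fun σ x => by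
    rw [← resK_apply, hs]; rfl
  have hcyc : ∀ ζ : MuStar K, ζ.1 ^ a = ε.1 → (ζ.1 : K) ∈ cyc K m := fun ζ hζ =>
    mem_cyc_of_pow_eq_one m _ (IsPrimitiveRoot.coe_units_iff.2 (hm ζ hζ)).pow_eq_one
  have hεn : (ε.1 : K) ∈ cyc K n :=
    mem_cyc_of_pow_eq_one n _ (IsPrimitiveRoot.coe_units_iff.2 hε).pow_eq_one
  refine Finset.prod_bij (fun σ _ => galMu (s σ) ξ) ?_ ?_ ?_ ?_
  · intro σ _
    simp only [Set.Finite.mem_toFinset, Set.mem_ofPred_eq]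
    show (Units.map (s σ : K →* K) ξ.1) ^ a = ε.1
    rw [← map_pow, hξ]
    apply Units.ext
    have h1 := hs' σ (algebraMap (cyc K n) (cyc K m) ⟨ε.1, hεn⟩)
    rw [AlgEquiv.commutes, hval] at h1
    exact h1
  · intro σ _ σ' _ e
    have e1 : s σ (ξ.1 : K) = s σ' ξ.1 := congrArg (fun ζ : MuStar K => (ζ.1 : K)) e
    ext x
    rw [← hs', ← hs']
    exact gal_eq_on_cyc m (hm ξ hξ) e1 x x.2
  · intro ζ hζ
    simp only [Set.Finite.mem_toFinset, Set.mem_ofPred_eq] at hζ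
    obtain ⟨ρ, hρ⟩ := exists_gal_map_eq m.pos (hm ξ hξ) (hm ζ hζ)
    have hρε : ρ (ε.1 : K) = (1 : Gal(K/ℚ)) (ε.1 : K) := by
      have : Units.map (ρ : K →* K) ε.1 = ε.1 := by rw [← hξ, map_pow, hρ, hζ, hξ]
      exact congrArg Units.val this
    refine ⟨AlgEquiv.ofRingEquiv (f := (resK m ρ).toRingEquiv) fun x => ?_, Finset.mem_univ _, ?_⟩
    · apply Subtype.ext
      refine (resK_apply m ρ _).trans ?_
      rw [hval]
      exact gal_eq_on_cyc n hε hρε x x.2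
    · refine Subtype.ext (Eq.trans (Units.ext ?_) hρ)
      refine (hs' _ ⟨ξ.1, hcyc ξ hξ⟩).trans ?_
      exact resK_apply m ρ ⟨ξ.1, hcyc ξ hξ⟩
  · intro σ _
    rw [val_galMu]
    exact (hs' σ _).symm

open IsDedekindDomain NumberField in
/-- The value of a distribution at `ε` is a unit at every prime `v` that does not lie above some
prime factor `ℓ` of the order `n` of `ε`: this value is a norm from `ℚ(n ℓ ^ k)` for every `k`, so
its valuation at `v` is divisible by unbounded residue degrees. -/
lemma valuation_valCyc_eq_one {f : F K} (hf : f ∈ Fd K) {n : ℕ+} {ε : MuStar K}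
    (hε : IsPrimitiveRoot ε.1 n) {ℓ : ℕ} (hl : ℓ.Prime) (hln : ℓ ∣ n)
    (v : HeightOneSpectrum (𝓞 (cyc K n))) (hv : (ℓ : 𝓞 (cyc K n)) ∉ v.asIdeal) :
    v.valuation (cyc K n) (valCyc f ε n hε.pow_eq_one) = 1 := by
  have key : ∀ k : ℕ, ∃ (d : ℕ) (t : ℤ), ℓ ^ k ≤ Ideal.absNorm v.asIdeal ^ d ∧
      v.valuation (cyc K n) (valCyc f ε n hε.pow_eq_one) = WithZero.exp (d * t) := by
    intro k
    have hlk : 0 < ℓ ^ k := pow_pos hl.pos k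
    obtain ⟨y, hy⟩ := exists_unit_pow_eq ε.1 (ℓ ^ k) hlk
    have hm : ∀ ζ : MuStar K, ζ.1 ^ (ℓ ^ k) = ε.1 →
        IsPrimitiveRoot ζ.1 (n * ⟨ℓ ^ k, hlk⟩ : ℕ+) := fun ζ hζ =>
      isPrimitiveRoot_of_pow hlk (by rwa [hζ]) fun p hp hpl => by
        rwa [(Nat.prime_dvd_prime_iff_eq hp hl).1 (hp.dvd_of_dvd_pow hpl)]
    let ξ : MuStar K := ⟨y, by
      rw [← isOfFinOrder_pow.trans (or_iff_left hlk.ne'), hy]; exact ε.2.1, by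
      rintro rfl; rw [one_pow] at hy; exact ε.2.2 hy.symm⟩
    let := cycAlgebra (K := K) (dvd_mul_right n ⟨ℓ ^ k, hlk⟩)
    have := cycAlgebra_isGalois (K := K) (dvd_mul_right n ⟨ℓ ^ k, hlk⟩)
    obtain ⟨ω, hω⟩ : ∃ ω : cyc K (n * ⟨ℓ ^ k, hlk⟩), IsPrimitiveRoot ω (ℓ ^ k) := by
      have h0 := IsCyclotomicExtension.zeta_spec ((n * ⟨ℓ ^ k, hlk⟩ : ℕ+) : ℕ) ℚ
        (cyc K (n * ⟨ℓ ^ k, hlk⟩))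
      exact ⟨_, h0.pow (PNat.pos _) rfl⟩
    obtain ⟨d, t, h1, h2⟩ := exists_valuation_norm_eq_of_isPrimitiveRoot v hlk
      (fun h => hv (by
        rw [Nat.cast_pow] at h
        exact v.isPrime.mem_of_pow_mem k h)) hω _
      (valCyc_ne_zero f ξ _ (hm ξ hy).pow_eq_one)
    rw [norm_valCyc hf (dvd_mul_right n ⟨ℓ ^ k, hlk⟩) hlk hε hy hm] at h2
    exact ⟨d, t, h1, h2⟩
  obtain ⟨d₀, t₀, -, h₀⟩ := key 0
  set u : ℤ := d₀ * t₀ with hu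
  have hu0 : u = 0 := by
    by_contra hu0
    obtain ⟨k, hk⟩ := pow_unbounded_of_one_lt (Ideal.absNorm v.asIdeal ^ u.natAbs) hl.one_lt
    obtain ⟨d, t, h1, h2⟩ := key k
    rw [h₀, WithZero.exp_inj] at h2
    have hd : d ≤ u.natAbs := Nat.le_of_dvd (Int.natAbs_pos.2 hu0)
      (Int.natCast_dvd.1 ⟨t, h2⟩)
    have hN : 0 < Ideal.absNorm v.asIdeal := Nat.pos_of_ne_zero fun h =>
      v.ne_bot (Ideal.absNorm_eq_zero_iff.1 h)
    exact absurd (h1.trans (Nat.pow_le_pow_right hN hd)) (not_le.2 hk)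
  rw [h₀, hu0, WithZero.exp_zero]

open IsDedekindDomain NumberField in
lemma isIntegral_valCyc {f : F K} (hf : f ∈ Fd K) {n : ℕ+} {ε : MuStar K}
    (hε : IsPrimitiveRoot ε.1 n) {ℓ q : ℕ} (hl : ℓ.Prime) (hq : q.Prime) (hlq : ℓ ≠ q)
    (hln : ℓ ∣ n) (hqn : q ∣ n) : IsIntegral ℤ (valCyc f ε n hε.pow_eq_one) := by
  obtain ⟨y, hy⟩ := HeightOneSpectrum.mem_integers_of_valuation_le_one (R := 𝓞 (cyc K n))
    (cyc K n) (valCyc f ε n hε.pow_eq_one) fun v => le_of_eq (by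
      by_cases h : (ℓ : 𝓞 (cyc K n)) ∈ v.asIdeal
      · refine valuation_valCyc_eq_one hf hε hq hqn v fun h' => v.isPrime.one_notMem ?_
        obtain ⟨x, y, hxy⟩ := Nat.isCoprime_iff_coprime.2 ((Nat.coprime_primes hl hq).2 hlq)
        have : (1 : 𝓞 (cyc K n)) = x * ℓ + y * q := by exact_mod_cast hxy.symm
        rw [this]
        exact v.asIdeal.add_mem (v.asIdeal.mul_mem_left _ h) (v.asIdeal.mul_mem_left _ h')
      · exact valuation_valCyc_eq_one hf hε hl hln v h)
  rw [← hy]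
  exact RingOfIntegers.isIntegral_coe y

/-! ### The kernel of `1 + τ` -/

/-- Complex conjugation on `ℚ(n)` is independent of the complex embedding. -/
lemma star_cyc (ι : K →+* ℂ) (n : ℕ+) (φ : cyc K n →+* ℂ) (x : cyc K n) :
    φ (resK n (conjK ι) x) = (starRingEnd ℂ) (φ x) := by
  obtain ⟨ζ, hζ⟩ := exists_isPrimitiveRoot K n n.pos
  have hmem := mem_cyc_of_pow_eq_one n (ζ : K) (IsPrimitiveRoot.coe_units_iff.2 hζ).pow_eq_one
  have h1 : (⟨ζ, hmem⟩ : cyc K n) ^ (n : ℕ) = 1 :=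
    Subtype.ext (IsPrimitiveRoot.coe_units_iff.2 hζ).pow_eq_one
  have key : φ (resK n (conjK ι) ⟨ζ, hmem⟩) = (starRingEnd ℂ) (φ ⟨ζ, hmem⟩) := by
    have h2 : resK n (conjK ι) ⟨ζ, hmem⟩ = (⟨ζ, hmem⟩ : cyc K n)⁻¹ := by
      apply Subtype.ext
      rw [resK_apply]
      have := conjK_map ι ζ (isOfFinOrder_iff_pow_eq_one.2 ⟨n, n.pos, hζ.pow_eq_one⟩)
      rw [Units.ext_iff, Units.val_inv_eq_inv_val] at this
      exact this
    rw [h2, map_inv₀, Complex.inv_eq_conj]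
    exact Complex.norm_eq_one_of_pow_eq_one (by rw [← map_pow, h1, map_one]) n.ne_zero
  obtain ⟨x, hx⟩ := x
  have hx' := hx
  rw [← adjoin_eq_cyc n hζ] at hx'
  have hle : IntermediateField.adjoin ℚ {(ζ : K)} ≤ cyc K n := (adjoin_eq_cyc n hζ).le
  induction hx' using IntermediateField.adjoin_induction with
  | mem y hy => obtain rfl := hy; exact key
  | algebraMap q =>
    have : (⟨algebraMap ℚ K q, hx⟩ : cyc K n) = algebraMap ℚ (cyc K n) q := rfl
    rw [this, AlgEquiv.commutes]
    simp
  | add y z hy hz hy' hz' =>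
    have : (⟨y + z, hx⟩ : cyc K n) = ⟨y, hle hy⟩ + ⟨z, hle hz⟩ := rfl
    rw [this, map_add, map_add, map_add, map_add, hy', hz']
  | inv y hy hy' =>
    have : (⟨y⁻¹, hx⟩ : cyc K n) = (⟨y, hle hy⟩ : cyc K n)⁻¹ := rfl
    rw [this, map_inv₀, map_inv₀, map_inv₀, map_inv₀, hy']
  | mul y z hy hz hy' hz' =>
    have : (⟨y * z, hx⟩ : cyc K n) = ⟨y, hle hy⟩ * ⟨z, hle hz⟩ := rfl
    rw [this, map_mul, map_mul, map_mul, map_mul, hy', hz']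

lemma val_one_add_tau_smul (ι : K →+* ℂ) (f : F K) (ζ : MuStar K) :
    val ((1 + tau ι) • f) ζ = val f ζ * Units.map (conjK ι : K →* K) (val f ζ) := by
  rw [add_smul, one_smul, val_add]
  congr 1
  exact Units.ext (val_galR_smul _ _ _)

/-- By Kronecker's theorem, a distribution killed by `1 + τ` takes values of finite order at the
roots of unity whose order is not a prime power. -/
lemma isOfFinOrder_val_of_two_primes (ι : K →+* ℂ) {f : F K} (hf : f ∈ Fd K)
    (h0 : (1 + tau ι) • f = 0) {n : ℕ+} {ε : MuStar K}
    (hε : IsPrimitiveRoot ε.1 n) {ℓ q : ℕ} (hl : ℓ.Prime) (hq : q.Prime) (hlq : ℓ ≠ q)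
    (hln : ℓ ∣ n) (hqn : q ∣ n) : IsOfFinOrder (val f ε) := by
  have hv := val_one_add_tau_smul ι f ε
  rw [h0, val_zero] at hv
  obtain ⟨N, hN, h⟩ := NumberField.Embeddings.pow_eq_one_of_norm_eq_one (cyc K n) ℂ
    (isIntegral_valCyc hf hε hl hq hlq hln hqn) fun φ => by
      have h1 : valCyc f ε n hε.pow_eq_one *
          resK n (conjK ι) (valCyc f ε n hε.pow_eq_one) = 1 := by
        apply Subtype.ext
        refine Eq.trans ?_ (congrArg Units.val hv).symm
        exact congrArg ((val f ε : K) * ·) (resK_apply n _ _)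
      have h2 := congrArg φ h1
      rw [map_mul, star_cyc, Complex.mul_conj, map_one, Complex.normSq_eq_norm_sq] at h2
      have h3 : ‖φ (valCyc f ε n hε.pow_eq_one)‖ ^ 2 = 1 := by exact_mod_cast h2
      exact (pow_eq_one_iff_of_nonneg (norm_nonneg _) two_ne_zero).1 h3
  exact isOfFinOrder_iff_pow_eq_one.2 ⟨N, hN, Units.ext (congrArg Subtype.val h)⟩

/-- A distribution killed by `1 + τ` is torsion-valued. For the roots of unity of prime power order
`n`, the distribution relation for an exponent congruent to `-1` modulo `n` reduces this to orders
with two prime factors. -/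
lemma isOfFinOrder_val (ι : K →+* ℂ) {f : F K} (hf : f ∈ Fd K)
    (h0 : (1 + tau ι) • f = 0) (ε : MuStar K) : IsOfFinOrder (val f ε) := by
  obtain ⟨n, hn⟩ : ∃ n, n = orderOf ε.1 := ⟨_, rfl⟩
  have hε : IsPrimitiveRoot ε.1 n := hn ▸ IsPrimitiveRoot.orderOf ε.1
  have hn0 : 0 < n := hn ▸ ε.2.1.orderOf_pos
  have hn1 : n ≠ 1 := fun h => ε.2.2 (orderOf_eq_one_iff.1 (hn ▸ h))
  obtain ⟨ℓ, hl, hln⟩ := Nat.exists_prime_and_dvd hn1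
  -- an exponent congruent to `-1` modulo the order of `ε`
  obtain ⟨a, ha⟩ : ∃ a, a + 1 = 2 * n := ⟨2 * n - 1, by omega⟩
  have ha0 : 0 < a := by omega
  have hν : ε.1⁻¹ ^ a = ε.1 := by
    rw [inv_pow, inv_eq_iff_mul_eq_one, ← pow_succ, ha, mul_comm, pow_mul, hε.pow_eq_one, one_pow]
  let ν : MuStar K := ⟨ε.1⁻¹, ε.2.1.inv, inv_ne_one.2 ε.2.2⟩
  have hνf : val f ν = (val f ε)⁻¹ := by
    have hv := val_one_add_tau_smul ι f ε
    rw [h0, val_zero] at hv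
    have : ν = galMu (conjK ι) ε := Subtype.ext (conjK_map ι ε.1 ε.2.1).symm
    rw [this, val_galMu]
    exact eq_inv_of_mul_eq_one_right hv.symm
  have hfd := hf a ha0 ε
  rw [finprod_mem_eq_finite_toFinset_prod _ (finite_fiber a ha0 ε)] at hfd
  classical
  rw [← Finset.mul_prod_erase _ _ (a := ν) (by simpa using (show ν.1 ^ a = ε.1 from hν)), hνf,
    inv_mul_eq_iff_eq_mul, ← sq] at hfd
  refine (isOfFinOrder_pow (n := 2)).1 ?_ |>.resolve_right two_ne_zero
  rw [← hfd]
  refine (CommGroup.torsion Kˣ).prod_mem fun ζ hζ => ?_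
  obtain ⟨hζν, hζ⟩ := Finset.mem_erase.1 hζ
  have hζ : ζ.1 ^ a = ε.1 := by simpa using hζ
  -- the order of `ζ` is divisible by `n` and by the order of `ζ * ε`, which divides `a`
  have hξ : (ζ.1 * ε.1) ≠ 1 := fun h => hζν (Subtype.ext (eq_inv_of_mul_eq_one_left h))
  have hξa : (ζ.1 * ε.1) ^ a = 1 := by
    rw [mul_pow, hζ, ← pow_succ', ha, mul_comm, pow_mul, hε.pow_eq_one, one_pow]
  obtain ⟨q, hq, hqξ⟩ := Nat.exists_prime_and_dvd (mt orderOf_eq_one_iff.1 hξ)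
  have hqa : q ∣ a := hqξ.trans (orderOf_dvd_of_pow_eq_one hξa)
  have hqζ : q ∣ orderOf ζ.1 := by
    refine hqξ.trans (orderOf_dvd_of_pow_eq_one ?_)
    rw [← hζ, ← pow_succ', ← pow_mul, mul_comm, pow_mul, pow_orderOf_eq_one, one_pow]
  have hnζ : n ∣ orderOf ζ.1 := by
    rw [hn, ← hζ]; exact orderOf_pow_dvd a
  refine isOfFinOrder_val_of_two_primes ι hf h0 (n := ⟨orderOf ζ.1, ζ.2.1.orderOf_pos⟩)
    (IsPrimitiveRoot.orderOf ζ.1) hl hq ?_ (hln.trans hnζ) hqζ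
  rintro rfl
  refine hl.one_lt.ne' (Nat.dvd_one.1 ((Nat.dvd_add_right hqa).1 ?_))
  rw [ha]
  exact hln.mul_left 2

lemma mem_FdTv_iff (ι : K →+* ℂ) (f : F K) :
    f ∈ FdTv K ↔ f ∈ Fd K ∧ (1 + tau ι) • f = 0 := by
  refine ⟨fun h => ⟨h.1, F.ext fun ζ => ?_⟩, fun h => ⟨h.1, isOfFinOrder_val ι h.1 h.2⟩⟩
  rw [val_one_add_tau_smul, conjK_map ι _ (h.2 ζ), mul_inv_cancel, val_zero]

/-! ### The action of the group rings on roots of unity -/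

/-- For even `n` dividing `m`, there is a unit `t` modulo `m` such that `1 + n t` is a unit as well.
This fails for odd `n` and even `m`. -/
lemma exists_coprime_coprime_one_add_mul {n m : ℕ} (hn : 2 ∣ n) (hm : 0 < m) (h : n ∣ m) :
    ∃ t : ℕ, t.Coprime m ∧ (1 + n * t).Coprime m := by
  have hn0 : 0 < n := Nat.pos_of_dvd_of_pos h hm
  -- `t` is chosen such that `t ≡ 1` modulo the primes dividing `n`, and `n t ≡ 1` modulo the other
  -- prime factors of `m`, which are odd
  let Q := ∏ p ∈ m.primeFactors with ¬ p ∣ n, p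
  have hcop : n.Coprime Q := Nat.Coprime.prod_right fun p hp => by
    obtain ⟨hp, hpn⟩ := Finset.mem_filter.1 hp
    exact ((Nat.Prime.coprime_iff_not_dvd (Nat.prime_of_mem_primeFactors hp)).2 hpn).symm
  have hw : n * (n : ZMod Q)⁻¹.val ≡ 1 [MOD Q] := by
    have hQ : NeZero Q := ⟨(Finset.prod_pos fun p hp =>
      (Nat.prime_of_mem_primeFactors (Finset.mem_filter.1 hp).1).pos).ne'⟩
    rw [← ZMod.natCast_eq_natCast_iff]
    push_cast
    rw [ZMod.natCast_zmod_val, ZMod.coe_mul_inv_eq_one n hcop]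
  obtain ⟨t, ht, htw⟩ := Nat.chineseRemainder hcop 1 (n : ZMod Q)⁻¹.val
  have htQ : n * t ≡ 1 [MOD Q] := (htw.mul_left n).trans hw
  have hpQ : ∀ p : ℕ, p.Prime → p ∣ m → ¬ p ∣ n → n * t ≡ 1 [MOD p] := fun p hp hpm hpn =>
    htQ.of_dvd (Finset.dvd_prod_of_mem _ (Finset.mem_filter.2
      ⟨Nat.mem_primeFactors.2 ⟨hp, hpm, hm.ne'⟩, hpn⟩))
  refine ⟨t, Nat.Coprime.symm (Nat.coprime_of_dvd fun p hp hpm hpt => ?_),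
    Nat.Coprime.symm (Nat.coprime_of_dvd fun p hp hpm hpt => ?_)⟩
  · by_cases hpn : p ∣ n
    · have := (ht.of_dvd hpn).symm.trans (Nat.modEq_zero_iff_dvd.2 hpt)
      exact hp.one_lt.ne' (Nat.dvd_one.1 (Nat.modEq_zero_iff_dvd.1 this))
    · have := (hpQ p hp hpm hpn).symm.trans (Nat.modEq_zero_iff_dvd.2 (hpt.mul_left n))
      exact hp.one_lt.ne' (Nat.dvd_one.1 (Nat.modEq_zero_iff_dvd.1 this))
  · by_cases hpn : p ∣ n
    · exact hp.one_lt.ne' (Nat.dvd_one.1 ((Nat.dvd_add_left (hpn.mul_right t)).1 hpt))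
    · have := ((hpQ p hp hpm hpn).add_left 1).symm.trans (Nat.modEq_zero_iff_dvd.2 hpt)
      have h2 := (Nat.prime_dvd_prime_iff_eq hp Nat.prime_two).1 (Nat.modEq_zero_iff_dvd.1 this)
      exact hpn (h2 ▸ hn)

/-- The element `s` of `ℤ[G_n]` acts on the `n`-th roots of unity by raising to the power `c`. -/
def ActsBy (n : ℕ+) (s : Rn K n) (c : ℤ) : Prop :=
  ∀ y : Additive (cyc K n)ˣ, (n : ℕ) • y = 0 → actn n s y = c • y

lemma ActsBy.add {n : ℕ+} {s s' : Rn K n} {c c' : ℤ} (h : ActsBy n s c) (h' : ActsBy n s' c') :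
    ActsBy n (s + s') (c + c') := fun y hy => by
  rw [actn_add, h y hy, h' y hy, add_zsmul]

lemma actsBy_single {n : ℕ+} {σ : Gal(K/ℚ)} {a : ℕ}
    (h : ∀ x : Kˣ, x ^ (n : ℕ) = 1 → Units.map (σ : K →* K) x = x ^ a) (k : ℤ) :
    ActsBy n (MonoidAlgebra.single (resK n σ) k) (k * a) := fun y hy => by
  rw [actn_single, mul_smul]
  congr 1
  apply incl_injective
  apply UAb.unit_injective
  have hu : (incl n y).unit ^ (n : ℕ) = 1 := by
    rw [← UAb.unit_nsmul, ← map_nsmul, hy, map_zero, UAb.unit_zero]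
  rw [map_zsmul, UAb.unit_zsmul, zpow_natCast, ← h _ hu]
  exact Units.ext (resK_apply n σ _)

lemma exists_actsBy (n : ℕ+) (s : Rn K n) : ∃ c, ActsBy n s c := by
  induction s using MonoidAlgebra.induction_linear with
  | zero => exact ⟨0, fun y _ => by rw [map_zero, zero_smul]; rfl⟩
  | add a b ha hb =>
    obtain ⟨c, hc⟩ := ha
    obtain ⟨d, hd⟩ := hb
    exact ⟨c + d, hc.add hd⟩
  | single g k =>
    obtain ⟨σ, rfl⟩ := resK_surjective n g
    obtain ⟨a, ha⟩ := gal_pow n σ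
    exact ⟨_, actsBy_single ha k⟩

lemma ActsBy.congr {n : ℕ+} {s : Rn K n} {c c' : ℤ} (h : ActsBy n s c) (hc : (n : ℤ) ∣ c' - c) :
    ActsBy n s c' := fun y hy => by
  obtain ⟨d, hd⟩ := hc
  rw [h y hy, eq_add_of_sub_eq hd, add_zsmul, mul_comm, mul_zsmul, natCast_zsmul, hy, zsmul_zero,
    zero_add]

lemma ActsBy.dvd_sub {n : ℕ+} {s : Rn K n} {c c' : ℤ} (h : ActsBy n s c) (h' : ActsBy n s c') :
    (n : ℤ) ∣ c' - c := by
  obtain ⟨ζ, hζ⟩ := exists_isPrimitiveRoot K n n.pos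
  have hmem := mem_cyc_of_pow_eq_one n (ζ : K) (IsPrimitiveRoot.coe_units_iff.2 hζ).pow_eq_one
  obtain ⟨x, hx⟩ : ∃ x : UAb K, x.unit = ζ := ⟨UAb.mk ζ ⟨n, hmem⟩, rfl⟩
  obtain ⟨y, hy⟩ := exists_incl_of_mem n x (by rwa [hx])
  have hny : (n : ℕ) • y = 0 := by
    apply incl_injective
    apply UAb.unit_injective
    rw [map_nsmul, UAb.unit_nsmul, hy, hx, hζ.pow_eq_one, map_zero, UAb.unit_zero]
  have := congrArg (fun z => (incl n z).unit) ((h' y hny).symm.trans (h y hny))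
  simp only [map_zsmul, hy, UAb.unit_zsmul, hx] at this
  rw [← hζ.zpow_eq_one_iff_dvd, zpow_sub, this, mul_inv_cancel]

lemma up_injective {n m : ℕ+} (h : n ∣ m) : Function.Injective (up (K := K) h) := fun x y e =>
  incl_injective n (by rw [← incl_up h, e, incl_up h])

lemma ActsBy.resR {n m : ℕ+} (h : n ∣ m) {s : Rn K m} {c : ℤ} (hs : ActsBy m s c) :
    ActsBy n (resR h s) c := fun y hy => by
  apply up_injective h
  obtain ⟨k, hk⟩ := PNat.dvd_iff.1 h
  rw [← actn_up, hs, map_zsmul]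
  rw [← map_nsmul, hk, mul_comm, mul_smul, hy, smul_zero, map_zero]

lemma resR_surjective {n m : ℕ+} (h : n ∣ m) : Function.Surjective (resR (K := K) h) := by
  intro s
  induction s using MonoidAlgebra.induction_linear with
  | zero => exact ⟨0, map_zero _⟩
  | add a b ha hb =>
    obtain ⟨a, rfl⟩ := ha
    obtain ⟨b, rfl⟩ := hb
    exact ⟨a + b, map_add _ _ _⟩
  | single g k =>
    obtain ⟨σ, rfl⟩ := resK_surjective n g
    exact ⟨MonoidAlgebra.single (resK m σ) k, by rw [resR_single, res_resK]⟩

lemma resR_resR {n m k : ℕ+} (h : n ∣ m) (h' : m ∣ k) (s : Rn K k) :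
    resR h (resR h' s) = resR (h.trans h') s := by
  induction s using MonoidAlgebra.induction_linear with
  | zero => simp only [map_zero]
  | add a b ha hb => rw [map_add, map_add, map_add, ha, hb]
  | single g c =>
    obtain ⟨σ, rfl⟩ := resK_surjective k g
    rw [resR_single, resR_single, resR_single, res_resK, res_resK, res_resK]

lemma resR_refl {n : ℕ+} (h : n ∣ n) (s : Rn K n) : resR h s = s := by
  induction s using MonoidAlgebra.induction_linear with
  | zero => simp only [map_zero]
  | add a b ha hb => rw [map_add, ha, hb]
  | single g c =>
    obtain ⟨σ, rfl⟩ := resK_surjective n g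
    rw [resR_single, res_resK]

/-- Along `n ∣ m` with `n` even, an element of `ℤ[G_n]` with exponent `c` lifts to an element of
`ℤ[G_m]` with any prescribed exponent `d ≡ c` modulo `n`. -/
lemma exists_lift_actsBy {n m : ℕ+} (hn : 2 ∣ (n : ℕ)) (h : n ∣ m) {s : Rn K n} {c d : ℤ}
    (hs : ActsBy n s c) (hcd : (n : ℤ) ∣ d - c) :
    ∃ s' : Rn K m, resR h s' = s ∧ ActsBy m s' d := by
  obtain ⟨s₁, rfl⟩ := resR_surjective h s
  obtain ⟨e, he⟩ := exists_actsBy m s₁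
  obtain ⟨u, hu⟩ : (n : ℤ) ∣ d - e := by
    have := (he.resR h).dvd_sub hs
    have := dvd_add hcd this
    rwa [sub_add_sub_cancel] at this
  obtain ⟨t, ht, ht'⟩ := exists_coprime_coprime_one_add_mul hn m.pos (PNat.dvd_iff.1 h)
  -- `σ - 1` lies in the kernel of `ℤ[G_m] → ℤ[G_n]` and has exponent `n t`; its multiple by the
  -- inverse `v` of `t` modulo `m` has exponent `n`
  obtain ⟨v, w, hvw⟩ := Nat.isCoprime_iff_coprime.2 ht
  obtain ⟨σ, hσ⟩ := exists_gal_pow (K := K) m _ ht'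
  have hres : resK n σ = 1 := by
    obtain ⟨ζ, hζ⟩ := exists_isPrimitiveRoot K n n.pos
    ext x
    rw [resK_apply]
    refine gal_eq_on_cyc n (ρ := 1) hζ ?_ x x.2
    refine congrArg Units.val ((hσ ζ ?_).trans ?_)
    · obtain ⟨k, rfl⟩ := h
      rw [PNat.mul_coe, pow_mul, hζ.pow_eq_one, one_pow]
    · rw [pow_add, pow_mul, hζ.pow_eq_one, one_pow, mul_one, pow_one]
  have h1 := actsBy_single (n := m) (σ := (1 : Gal(K/ℚ))) (a := 1)
    (fun x _ => (Units.ext rfl).trans (pow_one x).symm) (-(u * v))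
  refine ⟨s₁ + (MonoidAlgebra.single (resK m σ) (u * v) +
    MonoidAlgebra.single (resK m 1) (-(u * v))), ?_, ?_⟩
  · rw [map_add, map_add, resR_single, resR_single, res_resK, res_resK, hres, map_one,
      ← MonoidAlgebra.single_add, add_neg_cancel, MonoidAlgebra.single_zero, add_zero]
  · refine (he.add ((actsBy_single hσ (u * v)).add h1)).congr ?_
    refine ⟨n * u * w, ?_⟩
    push_cast
    linear_combination hu - (n : ℤ) * u * hvw

open scoped Nat in
/-- A sequence of even numbers, each dividing the next, such that every number divides some member
of the sequence. -/
def level (k : ℕ) : ℕ+ := ⟨2 * k !, by positivity⟩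

lemma level_dvd {j k : ℕ} (h : j ≤ k) : level j ∣ level k :=
  PNat.dvd_iff.2 (Nat.mul_dvd_mul_left 2 (Nat.factorial_dvd_factorial h))

lemma dvd_level (n : ℕ+) : n ∣ level n :=
  PNat.dvd_iff.2 ((Nat.dvd_factorial n.pos le_rfl).mul_left 2)

lemma exists_incl_of_nsmul_eq_zero {n : ℕ+} {x : UAb K} (h : (n : ℕ) • x = 0) :
    ∃ y : Additive (cyc K n)ˣ, (n : ℕ) • y = 0 ∧ incl n y = x := by
  have hx : x.unit ^ (n : ℕ) = 1 := by rw [← UAb.unit_nsmul, h, UAb.unit_zero]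
  obtain ⟨y, rfl⟩ := exists_incl_of_mem n x (mem_cyc_of_pow_eq_one n _ (by
    rw [← Units.val_pow_eq_pow_val, hx, Units.val_one]))
  exact ⟨y, incl_injective n (by rw [map_nsmul, h, map_zero]), rfl⟩

/-- Every compatible family of exponents is realised by an element of `R`. It is constructed by
successive lifting along the sequence `level`. -/
lemma exists_smul_eq_zsmul (c : ℕ+ → ℤ) (hc : ∀ n m : ℕ+, n ∣ m → (n : ℤ) ∣ c m - c n) :
    ∃ r : R K, ∀ (n : ℕ+) (x : UAb K), (n : ℕ) • x = 0 → r • x = c n • x := by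
  have hstep : ∀ (k : ℕ) (s : {s : Rn K (level k) // ActsBy (level k) s (c (level k))}),
      ∃ s' : {s : Rn K (level (k + 1)) // ActsBy (level (k + 1)) s (c (level (k + 1)))},
        resR (level_dvd k.le_succ) s'.1 = s.1 := fun k s => by
    obtain ⟨s', h1, h2⟩ := exists_lift_actsBy (dvd_mul_right 2 _) (level_dvd k.le_succ) s.2
      (hc _ _ (level_dvd k.le_succ))
    exact ⟨⟨s', h2⟩, h1⟩
  choose next hnext using hstep
  have hzero : ActsBy (K := K) (level 0)
      (MonoidAlgebra.single (resK (level 0) 1) (c (level 0))) (c (level 0)) := by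
    have := actsBy_single (n := level 0) (σ := (1 : Gal(K/ℚ))) (a := 1)
      (fun x _ => (Units.ext rfl).trans (pow_one x).symm) (c (level 0))
    rwa [Nat.cast_one, mul_one] at this
  let s : ∀ k, {s : Rn K (level k) // ActsBy (level k) s (c (level k))} :=
    fun k => Nat.rec ⟨_, hzero⟩ next k
  have hs : ∀ {j k : ℕ} (h : j ≤ k), resR (level_dvd h) (s k).1 = (s j).1 := by
    intro j k h
    induction k, h using Nat.le_induction with
    | base => exact resR_refl _ _
    | succ k h ih => rw [← ih, ← hnext k (s k), resR_resR]
  obtain ⟨r, hr⟩ : ∃ r : R K, ∀ n : ℕ+, r.1 n = resR (dvd_level n) (s n).1 := by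
    refine ⟨⟨fun n => resR (dvd_level n) (s n).1, fun n m h => ?_⟩, fun n => rfl⟩
    have hnm : (n : ℕ) ≤ m := PNat.coe_le_coe _ _ |>.2 (PNat.le_of_dvd h)
    show resR h (resR (dvd_level m) (s m).1) = resR (dvd_level n) (s n).1
    rw [← hs hnm, resR_resR, resR_resR]
  refine ⟨r, fun n x hx => ?_⟩
  obtain ⟨y, hy, rfl⟩ := exists_incl_of_nsmul_eq_zero hx
  have h1 := ((s n).2.resR (dvd_level n)).congr (c' := c n) (by
    have := hc n _ (dvd_level n)
    rwa [← neg_sub, dvd_neg])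
  rw [smul_incl, hr, h1 y hy, map_zsmul]

/-! ### The exponents of a torsion-valued distribution -/

/-- The distribution `Φ^{1-τ}` is `ζ ↦ -ζ`. -/
lemma val_one_sub_tau_smul_Phi (ι : K →+* ℂ) (ζ : MuStar K) :
    val ((1 - tau ι) • Phi K) ζ = -ζ.1 := by
  have h : val ((1 - tau ι) • Phi K) ζ = val (Phi K) ζ / val (galR (conjK ι) • Phi K) ζ := by
    rw [sub_smul, one_smul]; rfl
  have h2 : val (galR (conjK ι) • Phi K) ζ = Units.map (conjK ι : K →* K) (val (Phi K) ζ) :=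
    Units.ext (val_galR_smul _ _ _)
  rw [h, h2, ← val_galMu, div_eq_iff_eq_mul]
  apply Units.ext
  have h3 : (galMu (conjK ι) ζ).1 = ζ.1⁻¹ := conjK_map ι ζ.1 ζ.2.1
  simp only [Phi, val_mk, Units.val_mk0, Units.val_mul, Units.val_neg, h3,
    Units.val_inv_eq_inv_val]
  field_simp
  ring

lemma one_sub_tau_smul_Phi_mem_Fd (ι : K →+* ℂ) : (1 - tau ι) • Phi K ∈ Fd K :=
  (Fd K).smul_mem _ Phi_mem_Fd

lemma isOfFinOrder_neg {ζ : Kˣ} (h : IsOfFinOrder ζ) : IsOfFinOrder (-ζ) := by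
  rw [neg_eq_neg_one_mul]
  exact (isOfFinOrder_iff_pow_eq_one.2 ⟨2, two_pos, by simp⟩ : IsOfFinOrder (-1 : Kˣ)).mul h

lemma one_sub_tau_smul_Phi_mem_FdTv (ι : K →+* ℂ) : (1 - tau ι) • Phi K ∈ FdTv K :=
  ⟨one_sub_tau_smul_Phi_mem_Fd ι, fun ζ => by
    rw [val_one_sub_tau_smul_Phi]; exact isOfFinOrder_neg ζ.2.1⟩

lemma _root_.IsPrimitiveRoot.neg_of_four_dvd {n : ℕ} (hn : 0 < n) (h4 : 4 ∣ n) {ζ : Kˣ}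
    (h : IsPrimitiveRoot ζ n) : IsPrimitiveRoot (-ζ) n := by
  obtain ⟨k, rfl⟩ := h4
  have h1 : ζ ^ (2 * k) = -1 := by
    have h2 : IsPrimitiveRoot (ζ ^ (2 * k)) 2 := h.pow hn (by ring)
    exact Units.ext ((IsPrimitiveRoot.coe_units_iff.2 h2).eq_neg_one_of_two_right)
  have h2 : -ζ = ζ ^ (2 * k + 1) := by rw [pow_succ, h1, neg_one_mul]
  rw [h2]
  refine h.pow_of_coprime _ ?_
  have h2 : Nat.Coprime (2 * k + 1) (2 * k) := by simp
  have h3 : Nat.Coprime (2 * k + 1) 2 := (Nat.coprime_mul_iff_right.1 h2).1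
  rw [show 4 * k = 2 * (2 * k) by ring]
  exact h3.mul_right h2

/-- For `4 ∣ n`, the roots of unity in `ℚ(n)` are the powers of `-ζ`, for any `ζ` of order `n`. -/
lemma exists_exponent {f : F K} (hf : f ∈ FdTv K) {n : ℕ} (hn : 0 < n) (h4 : 4 ∣ n) :
    ∃ c : ℤ, ∀ ζ : MuStar K, IsPrimitiveRoot ζ.1 n → val f ζ = (-ζ.1) ^ c := by
  obtain ⟨ξ, hξ⟩ := exists_isPrimitiveRoot K n hn
  have hn1 : n ≠ 1 := by rintro rfl; omega
  let ξ' : MuStar K := ⟨ξ, isOfFinOrder_iff_pow_eq_one.2 ⟨n, hn, hξ.pow_eq_one⟩, fun h =>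
    hn1 (hξ.unique (h ▸ IsPrimitiveRoot.one))⟩
  obtain ⟨i, hi⟩ := exists_pow_eq_of_isPrimitiveRoot hn (hξ.neg_of_four_dvd hn h4)
    (pow_eq_one_of_mem_cyc ⟨n, hn⟩ (dvd_trans (by norm_num) h4) (hf.2 ξ')
      (val_mem_cyc f ξ' ⟨n, hn⟩ hξ.pow_eq_one))
  refine ⟨i, fun ζ hζ => ?_⟩
  obtain ⟨σ, hσ⟩ := exists_gal_map_eq hn hξ hζ
  have : ζ = galMu σ ξ' := Subtype.ext hσ.symm
  rw [this, val_galMu, hi, map_pow, zpow_natCast]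
  congr 1
  exact Units.ext (by simp [galMu, ξ'])

lemma prod_fiber {f : F K} (hf : f ∈ Fd K) {a : ℕ} (ha : 0 < a) (ε : MuStar K) :
    ∏ ζ ∈ (finite_fiber a ha ε).toFinset, val f ζ = val f ε := by
  rw [← finprod_mem_eq_finite_toFinset_prod _ (finite_fiber a ha ε)]
  exact hf a ha ε

lemma mem_fiber {a : ℕ} (ha : 0 < a) (ε ζ : MuStar K) :
    ζ ∈ (finite_fiber a ha ε).toFinset ↔ ζ.1 ^ a = ε.1 := by simp

/-- The distribution relation for `ζ ↦ -ζ`, which is `Φ^{1-τ}` for any complex embedding. -/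
lemma prod_fiber_neg {a : ℕ} (ha : 0 < a) (ε : MuStar K) :
    ∏ ζ ∈ (finite_fiber a ha ε).toFinset, (-ζ.1) = -ε.1 := by
  obtain ⟨ι⟩ : Nonempty (K →ₐ[ℚ] ℂ) :=
    have : Algebra.IsAlgebraic ℚ K := IsAlgClosure.isAlgebraic
    ⟨IsAlgClosed.lift⟩
  simp only [← val_one_sub_tau_smul_Phi (ι : K →+* ℂ)]
  exact prod_fiber (one_sub_tau_smul_Phi_mem_Fd _) ha ε

lemma exists_muStar_isPrimitiveRoot {n : ℕ} (hn : 1 < n) :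
    ∃ ζ : MuStar K, IsPrimitiveRoot ζ.1 n := by
  obtain ⟨ξ, hξ⟩ := exists_isPrimitiveRoot K n (by omega)
  exact ⟨⟨ξ, isOfFinOrder_iff_pow_eq_one.2 ⟨n, by omega, hξ.pow_eq_one⟩, fun h =>
    hn.ne' (hξ.unique (h ▸ IsPrimitiveRoot.one))⟩, hξ⟩

/-- If `p ∣ n`, then all `p`-th roots of an `ε` of order `n` have order `p n`. -/
lemma exponent_dvd_of_prime_dvd {f : F K} (hf : f ∈ Fd K) {n p : ℕ} (hn : 0 < n) (h4 : 4 ∣ n)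
    (hp : p.Prime) (hpn : p ∣ n) {c d : ℤ}
    (hc : ∀ ζ : MuStar K, IsPrimitiveRoot ζ.1 n → val f ζ = (-ζ.1) ^ c)
    (hd : ∀ ζ : MuStar K, IsPrimitiveRoot ζ.1 (p * n) → val f ζ = (-ζ.1) ^ d) :
    (n : ℤ) ∣ d - c := by
  obtain ⟨ε, hε⟩ := exists_muStar_isPrimitiveRoot (K := K) (n := n)
    (by have := Nat.le_of_dvd hn h4; omega)
  have h1 := prod_fiber hf hp.pos ε
  rw [Finset.prod_congr rfl fun ζ hζ => hd ζ (by
    rw [mul_comm]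
    exact isPrimitiveRoot_of_pow hp.pos (by rwa [(mem_fiber hp.pos ε ζ).1 hζ]) fun q hq hqp => by
      rwa [(Nat.prime_dvd_prime_iff_eq hq hp).1 hqp]), Finset.prod_zpow,
    prod_fiber_neg hp.pos, hc ε hε] at h1
  rw [← (hε.neg_of_four_dvd hn h4).zpow_eq_one_iff_dvd, zpow_sub, h1, mul_inv_cancel]

/-- If `p ∤ n`, then exactly one `p`-th root of an `ε` of order `n` has order `n`, and the others
have order `p n`; comparing with `ζ ↦ -ζ` leaves the factor `p - 1`. -/
lemma exponent_dvd_of_prime_not_dvd {f : F K} (hf : f ∈ Fd K) {n p : ℕ} (hn : 0 < n) (h4 : 4 ∣ n)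
    (hp : p.Prime) (hpn : ¬ p ∣ n) {c d : ℤ}
    (hc : ∀ ζ : MuStar K, IsPrimitiveRoot ζ.1 n → val f ζ = (-ζ.1) ^ c)
    (hd : ∀ ζ : MuStar K, IsPrimitiveRoot ζ.1 (p * n) → val f ζ = (-ζ.1) ^ d) :
    (n : ℤ) ∣ (p - 1 : ℕ) * (d - c) := by
  obtain ⟨η, hη⟩ := exists_muStar_isPrimitiveRoot (K := K) (n := n)
    (by have := Nat.le_of_dvd hn h4; omega)
  have hcop : p.Coprime n := (Nat.Prime.coprime_iff_not_dvd hp).2 hpn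
  have hε := hη.pow_of_coprime p hcop
  let ε : MuStar K := ⟨η.1 ^ p, η.2.1.pow, fun h => η.2.2 (by
    have := orderOf_dvd_of_pow_eq_one h
    rw [← hη.eq_orderOf] at this
    rw [← orderOf_eq_one_iff, ← hη.eq_orderOf]
    exact Nat.eq_one_of_dvd_coprimes hcop.symm dvd_rfl this)⟩
  have h1 := prod_fiber hf hp.pos ε
  have h2 := prod_fiber_neg hp.pos ε
  classical
  have hmem : η ∈ (finite_fiber p hp.pos ε).toFinset := (mem_fiber hp.pos ε η).2 rfl
  rw [← Finset.mul_prod_erase _ _ hmem] at h1 h2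
  rw [Finset.prod_congr rfl fun ζ hζ => hd ζ (by
    obtain ⟨hζη, hζ⟩ := Finset.mem_erase.1 hζ
    have hζ : ζ.1 ^ p = η.1 ^ p := (mem_fiber hp.pos ε ζ).1 hζ
    have hξ : orderOf (ζ.1 / η.1) = p := by
      have : Fact p.Prime := ⟨hp⟩
      refine orderOf_eq_prime (by rw [div_pow, hζ, div_self']) fun h => hζη (Subtype.ext ?_)
      exact div_eq_one.1 h
    have h3 : orderOf (ζ.1 / η.1 * η.1) = p * n := by
      rw [(Commute.all _ _).orderOf_mul_eq_mul_orderOf_of_coprime (by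
        rwa [hξ, ← hη.eq_orderOf]), hξ, ← hη.eq_orderOf]
    rw [div_mul_cancel] at h3
    exact h3 ▸ IsPrimitiveRoot.orderOf ζ.1), Finset.prod_zpow, hc η hη, hc ε hε] at h1
  -- the product of `-ζ` over the roots of order `p n` is `ε / η = η ^ (p - 1)`
  set Q := ∏ x ∈ (finite_fiber p hp.pos ε).toFinset.erase η, -x.1 with hQ
  have h5 : Q = η.1 ^ (p - 1) := by
    have h6 : η.1 * Q = η.1 * η.1 ^ (p - 1) := by
      rw [neg_mul, neg_inj] at h2
      rw [h2, ← pow_succ', Nat.sub_add_cancel hp.pos]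
    exact mul_left_cancel h6
  rw [← h2, mul_zpow, mul_right_inj, h5, ← zpow_natCast, ← zpow_mul, ← zpow_mul] at h1
  rw [← hη.zpow_eq_one_iff_dvd, mul_sub, zpow_sub, h1, mul_inv_cancel]

/-- The exponents of a distribution at the levels divisible by `4` form a compatible family. -/
lemma exponent_dvd_sub {f : F K} (hf : f ∈ Fd K) {c : ℕ → ℤ}
    (hc : ∀ n, 0 < n → 4 ∣ n → ∀ ζ : MuStar K, IsPrimitiveRoot ζ.1 n → val f ζ = (-ζ.1) ^ c n)
    (k : ℕ) (hk : 0 < k) (n : ℕ) (hn : 0 < n) (h4 : 4 ∣ n) : (n : ℤ) ∣ c (k * n) - c n := by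
  induction k using Nat.strong_induction_on generalizing n with
  | _ k ih =>
  have hcn := fun n hn (h4 : 4 ∣ n) k (hk : 0 < k) =>
    hc (k * n) (Nat.mul_pos hk hn) (h4.mul_left k)
  rcases eq_or_ne k 1 with rfl | hk1
  · simp
  by_cases hp : k.Prime
  · by_cases hpn : k ∣ n
    · exact exponent_dvd_of_prime_dvd hf hn h4 hp hpn (hc n hn h4) (hcn n hn h4 k hk)
    · have h2 := hp.two_le
      have hk0 : 0 < k - 1 := by omega
      -- comparison through the level `(k - 1) * n`, where the factor `k - 1` can be cancelled
      have e1 := ih (k - 1) (by omega) hk0 n hn h4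
      have e2 := ih (k - 1) (by omega) hk0 (k * n) (Nat.mul_pos hk hn) (h4.mul_left k)
      have hkn : ¬ k ∣ (k - 1) * n := fun h => (hp.dvd_mul.1 h).elim
        (fun h => absurd (Nat.le_of_dvd hk0 h) (by omega)) hpn
      have e3 := exponent_dvd_of_prime_not_dvd hf (Nat.mul_pos hk0 hn) (h4.mul_left _) hp hkn
        (hcn n hn h4 _ hk0) (hcn _ (Nat.mul_pos hk0 hn) (h4.mul_left _) k hk)
      rw [Nat.cast_mul] at e3
      have e3 := Int.dvd_of_mul_dvd_mul_left (by exact_mod_cast hk0.ne') e3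
      rw [show k * ((k - 1) * n) = (k - 1) * (k * n) from Nat.mul_left_comm _ _ _] at e3
      have e2' : (n : ℤ) ∣ c ((k - 1) * (k * n)) - c (k * n) :=
        dvd_trans (by push_cast; exact dvd_mul_left _ _) e2
      have := dvd_sub (dvd_add e3 e1) e2'
      rw [show c (k * n) - c n = c ((k - 1) * (k * n)) - c ((k - 1) * n) +
        (c ((k - 1) * n) - c n) - (c ((k - 1) * (k * n)) - c (k * n)) by ring]
      exact this
  · obtain ⟨a, ha, b, hb, rfl⟩ : ∃ a, (0 < a ∧ a < k) ∧ ∃ b, (0 < b ∧ b < k) ∧ a * b = k := by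
      obtain ⟨a, ha, h2, h3⟩ := Nat.exists_dvd_of_not_prime2 (by omega) hp
      obtain ⟨b, rfl⟩ := ha
      refine ⟨a, ⟨by omega, h3⟩, b, ⟨Nat.pos_of_mul_pos_left hk, ?_⟩, rfl⟩
      have : 0 < b := Nat.pos_of_ne_zero (by rintro rfl; simp at hk)
      nlinarith
    have e1 := ih a ha.2 ha.1 (b * n) (Nat.mul_pos hb.1 hn) (h4.mul_left _)
    have e2 := ih b hb.2 hb.1 n hn h4
    rw [← mul_assoc] at e1
    have e1' : (n : ℤ) ∣ c (a * b * n) - c (b * n) :=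
      dvd_trans (by push_cast; exact dvd_mul_left _ _) e1
    have := dvd_add e1' e2
    rwa [sub_add_sub_cancel] at this

/-! ### Torsion-valued and torsion distributions -/

/-- If `h` is a distribution that is trivial on the roots of unity of order divisible by `4`, then
it is trivial on those of even order. -/
lemma val_eq_one_of_even {h : F K} (hh : h ∈ Fd K)
    (h4 : ∀ ζ : MuStar K, 4 ∣ orderOf ζ.1 → val h ζ = 1) (ε : MuStar K)
    (hε : 2 ∣ orderOf ε.1) : val h ε = 1 := by
  rw [← prod_fiber hh two_pos ε]
  refine Finset.prod_eq_one fun ζ hζ => h4 ζ ?_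
  rw [mem_fiber two_pos] at hζ
  have h1 := isPrimitiveRoot_of_pow (ζ := ζ.1) (n := orderOf ε.1) two_pos
    (by rw [hζ]; exact IsPrimitiveRoot.orderOf _) fun p hp hp2 => by
      rwa [(Nat.prime_dvd_prime_iff_eq hp Nat.prime_two).1 hp2]
  rw [← h1.eq_orderOf]
  exact Nat.mul_dvd_mul_right hε 2

/-- A torsion-valued distribution that is trivial on the roots of unity of order divisible by `4`
has values `±1`. For `ε` of odd order, the value at `ε` is fixed by the automorphism that squares
`ε`. -/
lemma val_sq_eq_one {h : F K} (hh : h ∈ FdTv K)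
    (h4 : ∀ ζ : MuStar K, 4 ∣ orderOf ζ.1 → val h ζ = 1) (ε : MuStar K) : val h ε ^ 2 = 1 := by
  by_cases hε : 2 ∣ orderOf ε.1
  · rw [val_eq_one_of_even hh.1 h4 ε hε, one_pow]
  obtain ⟨n, hn⟩ : ∃ n : ℕ+, (n : ℕ) = orderOf ε.1 := ⟨⟨_, ε.2.1.orderOf_pos⟩, rfl⟩
  have hεn : ε.1 ^ (n : ℕ) = 1 := by rw [hn, pow_orderOf_eq_one]
  have hcop : Nat.Coprime 2 (orderOf ε.1) := (Nat.Prime.coprime_iff_not_dvd Nat.prime_two).2 hε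
  obtain ⟨σ, hσ⟩ := exists_gal_pow (K := K) n 2 (hn ▸ hcop)
  have hσε : (galMu σ ε).1 = ε.1 ^ 2 := hσ ε.1 hεn
  -- `ε` is the only square root of `ε ^ 2` of odd order
  have h1 : val h (galMu σ ε) = val h ε := by
    rw [← prod_fiber hh.1 two_pos (galMu σ ε)]
    refine Finset.prod_eq_single ε (fun ζ hζ hζε => ?_) fun h => absurd
      ((mem_fiber two_pos _ _).2 hσε.symm) h
    refine val_eq_one_of_even hh.1 h4 ζ ?_
    rw [mem_fiber two_pos, hσε] at hζ
    by_contra hodd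
    have hcop' : Nat.Coprime 2 (orderOf ζ.1) :=
      (Nat.Prime.coprime_iff_not_dvd Nat.prime_two).2 hodd
    refine hζε (Subtype.ext (div_eq_one.1 (orderOf_eq_one_iff.1
      (Nat.eq_one_of_dvd_coprimes (hcop'.mul_right hcop) ?_ ?_))))
    · exact orderOf_dvd_of_pow_eq_one (by rw [div_pow, hζ, div_self'])
    · refine orderOf_dvd_of_pow_eq_one ?_
      rw [div_pow, pow_mul, pow_orderOf_eq_one, one_pow, mul_comm, pow_mul, pow_orderOf_eq_one,
        one_pow, div_one]
  have h2 : val h ε ^ (2 * (n : ℕ)) = 1 := by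
    have := pow_eq_one_of_mem_cyc (2 * n) (by rw [PNat.mul_coe]; exact dvd_mul_right 2 _) (hh.2 ε)
      (cyc_mono (dvd_mul_left n 2) (val_mem_cyc h ε n hεn))
    rwa [PNat.mul_coe] at this
  -- `σ` fixes `val h ε` and squares its square
  have h3 := hσ (val h ε ^ 2) (by rw [← pow_mul]; exact h2)
  rw [map_pow, ← val_galMu, h1, sq (val h ε ^ 2)] at h3
  exact (mul_eq_left.1 h3.symm)

lemma mem_FdTor_iff (f : F K) : f ∈ FdTor K ↔ f ∈ Fd K ∧ IsOfFinAddOrder f := by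
  constructor
  · rintro ⟨x, hx, rfl⟩
    exact ⟨x.2, AddMonoidHom.isOfFinAddOrder (Fd K).subtype.toAddMonoidHom hx⟩
  · rintro ⟨h, h'⟩
    refine ⟨⟨f, h⟩, ?_, rfl⟩
    obtain ⟨n, hn, e⟩ := h'.exists_nsmul_eq_zero
    exact isOfFinAddOrder_iff_nsmul_eq_zero.2 ⟨n, hn, Subtype.ext e⟩

lemma val_nsmul (n : ℕ) (f : F K) (ζ : MuStar K) : val (n • f) ζ = val f ζ ^ n := rfl

lemma FdTor_le_FdTv : FdTor K ≤ FdTv K := fun f hf => by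
  rw [mem_FdTor_iff] at hf
  obtain ⟨n, hn, e⟩ := hf.2.exists_nsmul_eq_zero
  exact ⟨hf.1, fun ζ => isOfFinOrder_iff_pow_eq_one.2 ⟨n, hn, by
    rw [← val_nsmul, e, val_zero]⟩⟩

/-- Every torsion-valued distribution is a multiple of `Φ^{1-τ}` up to torsion. -/
lemma exists_sub_mem_FdTor (ι : K →+* ℂ) {f : F K} (hf : f ∈ FdTv K) :
    ∃ r : R K, f - r • (1 - tau ι) • Phi K ∈ FdTor K := by
  have hex : ∀ n : ℕ, ∃ c : ℤ, 0 < n → 4 ∣ n →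
      ∀ ζ : MuStar K, IsPrimitiveRoot ζ.1 n → val f ζ = (-ζ.1) ^ c := fun n => by
    by_cases h : 0 < n ∧ 4 ∣ n
    · obtain ⟨c, hc⟩ := exists_exponent hf h.1 h.2
      exact ⟨c, fun _ _ => hc⟩
    · exact ⟨0, fun h1 h2 => absurd ⟨h1, h2⟩ h⟩
  choose c hc using hex
  -- the exponents are defined at levels divisible by `4`, so level `n` uses the one at `4 n`
  have hdvd := exponent_dvd_sub hf.1 hc
  obtain ⟨r, hr⟩ := exists_smul_eq_zsmul (K := K) (fun n => c (4 * n)) fun n m h => by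
    obtain ⟨k, rfl⟩ := h
    have := hdvd k k.pos (4 * n) (by have := n.pos; omega) (dvd_mul_right 4 _)
    refine dvd_trans ?_ (this.trans (dvd_of_eq ?_))
    · push_cast; exact dvd_mul_left _ _
    · rw [PNat.mul_coe]; congr 2; ring_nf
  refine ⟨r, ?_⟩
  have hmem : f - r • (1 - tau ι) • Phi K ∈ FdTv K :=
    (FdTv K).sub_mem hf ((FdTv K).smul_mem r (one_sub_tau_smul_Phi_mem_FdTv ι))
  rw [mem_FdTor_iff]
  refine ⟨hmem.1, isOfFinAddOrder_iff_nsmul_eq_zero.2 ⟨2, two_pos, F.ext fun ζ => ?_⟩⟩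
  rw [val_nsmul, val_zero]
  refine val_sq_eq_one hmem (fun ζ h4 => ?_) ζ
  have hn := ζ.2.1.orderOf_pos
  have hprim : IsPrimitiveRoot ζ.1 (orderOf ζ.1) := IsPrimitiveRoot.orderOf _
  have hneg := hprim.neg_of_four_dvd hn h4
  have h1 : val (r • (1 - tau ι) • Phi K) ζ = (-ζ.1) ^ c (4 * orderOf ζ.1) := by
    have hu : (valAb ((1 - tau ι) • Phi K) ζ).unit = -ζ.1 := by
      rw [unit_valAb, val_one_sub_tau_smul_Phi]
    rw [val_smul, hr ⟨orderOf ζ.1, hn⟩, UAb.unit_zsmul, hu]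
    · rfl
    · apply UAb.unit_injective
      rw [UAb.unit_nsmul, hu, UAb.unit_zero]
      exact hneg.pow_eq_one
  have h2 : val (f - r • (1 - tau ι) • Phi K) ζ =
      val f ζ / val (r • (1 - tau ι) • Phi K) ζ := rfl
  rw [h2, h1, hc _ hn h4 ζ hprim, div_eq_one, ← div_eq_one, div_eq_mul_inv, ← zpow_sub,
    hneg.zpow_eq_one_iff_dvd, ← neg_sub, dvd_neg]
  exact hdvd 4 (by norm_num) _ hn h4

lemma mem_smul_Fc_iff (t : R K) (f : F K) :
    f ∈ t • Fc K ↔ ∃ r : R K, r • t • Phi K = f := by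
  rw [Submodule.mem_smul_pointwise_iff_exists]
  constructor
  · rintro ⟨x, hx, rfl⟩
    obtain ⟨r, rfl⟩ := Submodule.mem_span_singleton.1 hx
    exact ⟨r, smul_comm _ _ _⟩
  · rintro ⟨r, rfl⟩
    exact ⟨r • Phi K, Submodule.mem_span_singleton.2 ⟨r, rfl⟩, smul_comm _ _ _⟩

lemma one_sub_tau_smul_Fc_le_FdTv (ι : K →+* ℂ) : (1 - tau ι) • Fc K ≤ FdTv K := fun f hf => by
  obtain ⟨r, rfl⟩ := (mem_smul_Fc_iff _ _).1 hf
  exact (FdTv K).smul_mem r (one_sub_tau_smul_Phi_mem_FdTv ι)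

lemma FdTv_eq_sup (ι : K →+* ℂ) : FdTv K = FdTor K ⊔ (1 - tau ι) • Fc K := by
  refine le_antisymm (fun f hf => ?_) (sup_le FdTor_le_FdTv (one_sub_tau_smul_Fc_le_FdTv ι))
  obtain ⟨r, hr⟩ := exists_sub_mem_FdTor ι hf
  rw [Submodule.mem_sup]
  exact ⟨_, hr, _, (mem_smul_Fc_iff _ _).2 ⟨r, rfl⟩, sub_add_cancel _ _⟩

/-! ### The module generated by `Φ^{1-τ}` -/

/-- `Φ^{1-τ}` has the same annihilator as the group of all roots of unity. -/
lemma smul_one_sub_tau_smul_Phi_eq_zero_iff (ι : K →+* ℂ) (r : R K) :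
    r • (1 - tau ι) • Phi K = 0 ↔ ∀ x : UAb K, IsOfFinAddOrder x → r • x = 0 := by
  have hu : ∀ ζ, (valAb ((1 - tau ι) • Phi K) ζ).unit = -ζ.1 := fun ζ => by
    rw [unit_valAb, val_one_sub_tau_smul_Phi]
  constructor
  · intro h x hx
    obtain ⟨n, hn, hnx⟩ := hx.exists_nsmul_eq_zero
    obtain ⟨ζ, hζ⟩ := exists_muStar_isPrimitiveRoot (K := K) (n := 4 * n) (by omega)
    have hneg := hζ.neg_of_four_dvd (by omega) (dvd_mul_right 4 n)
    obtain ⟨i, hi⟩ := exists_pow_eq_of_isPrimitiveRoot (by omega) hneg (x := x.unit) (by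
      rw [← UAb.unit_nsmul, mul_smul, hnx, smul_zero, UAb.unit_zero])
    have hxi : x = i • valAb ((1 - tau ι) • Phi K) ζ :=
      UAb.unit_injective (by rw [UAb.unit_nsmul, hu, hi])
    have h0 : r • valAb ((1 - tau ι) • Phi K) ζ = 0 := by
      apply UAb.unit_injective
      rw [← val_smul, h, val_zero, UAb.unit_zero]
    rw [hxi, smul_comm, h0, smul_zero]
  · intro h
    refine F.ext fun ζ => ?_
    rw [val_smul, h, val_zero, UAb.unit_zero]
    obtain ⟨n, hn, hnx⟩ := (isOfFinOrder_neg ζ.2.1).exists_pow_eq_one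
    exact isOfFinAddOrder_iff_nsmul_eq_zero.2 ⟨n, hn, UAb.unit_injective (by
      rw [UAb.unit_nsmul, hu, hnx, UAb.unit_zero])⟩

/-- The group of roots of unity is divisible. -/
lemma exists_nsmul_eq_UAb (x : UAb K) (hx : IsOfFinAddOrder x) {N : ℕ} (hN : 0 < N) :
    ∃ y : UAb K, IsOfFinAddOrder y ∧ N • y = x := by
  obtain ⟨n, hn, hnx⟩ := hx.exists_nsmul_eq_zero
  obtain ⟨u, hu⟩ := exists_unit_pow_eq x.unit N hN
  have h1 : u ^ (N * n) = 1 := by rw [pow_mul, hu, ← UAb.unit_nsmul, hnx, UAb.unit_zero]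
  have hmem : u ∈ unitsAb K := ⟨⟨N * n, Nat.mul_pos hN hn⟩,
    mem_cyc_of_pow_eq_one _ _ (by
      show (u : K) ^ (N * n) = 1
      rw [← Units.val_pow_eq_pow_val, h1, Units.val_one])⟩
  exact ⟨UAb.mk u hmem, isOfFinAddOrder_iff_nsmul_eq_zero.2 ⟨N * n, Nat.mul_pos hN hn,
    UAb.unit_injective h1⟩, UAb.unit_injective hu⟩

/-- The module `(1 - τ) 𝓕ᶜ` is torsion-free: if `N r` kills all roots of unity, so does `r`, by
divisibility. -/
lemma FdTor_inf_one_sub_tau_smul_Fc (ι : K →+* ℂ) {f : F K} (h : f ∈ FdTor K)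
    (h' : f ∈ (1 - tau ι) • Fc K) : f = 0 := by
  obtain ⟨r, rfl⟩ := (mem_smul_Fc_iff _ _).1 h'
  obtain ⟨N, hN, e⟩ := ((mem_FdTor_iff _).1 h).2.exists_nsmul_eq_zero
  rw [← smul_assoc, smul_one_sub_tau_smul_Phi_eq_zero_iff] at e
  rw [smul_one_sub_tau_smul_Phi_eq_zero_iff]
  intro x hx
  obtain ⟨y, hy, rfl⟩ := exists_nsmul_eq_UAb x hx hN
  rw [smul_comm, ← smul_assoc, e y hy]

lemma unit_compAb (x : ZHat1 K) (m : ℕ+) : (compAb x m).unit = comp x m := rfl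

/-- A generator of `Ẑ(1)` has the same annihilator as the group of all roots of unity. -/
lemma smul_generator_eq_zero_iff {z : ZHat1 K}
    (hz : ∀ m : ℕ+, IsPrimitiveRoot (comp z m) (m : ℕ)) (r : R K) :
    r • z = 0 ↔ ∀ x : UAb K, IsOfFinAddOrder x → r • x = 0 := by
  constructor
  · intro h x hx
    obtain ⟨n, hn, hnx⟩ := hx.exists_nsmul_eq_zero
    lift n to ℕ+ using hn
    obtain ⟨i, hi⟩ := exists_pow_eq_of_isPrimitiveRoot n.pos (hz n) (x := x.unit) (by
      rw [← UAb.unit_nsmul, hnx, UAb.unit_zero])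
    have hxi : x = i • compAb z n :=
      UAb.unit_injective (by rw [UAb.unit_nsmul, unit_compAb, hi])
    have h0 : r • compAb z n = 0 := by
      exact congrFun ((compAb_smul r z).symm.trans ((congrArg compAb h).trans (map_zero _))) n
    rw [hxi, smul_comm, h0, smul_zero]
  · intro h
    apply compAb_injective
    rw [compAb_smul, map_zero]
    funext m
    exact h _ (isOfFinAddOrder_iff_nsmul_eq_zero.2 ⟨m, m.pos, compAb_nsmul z m⟩)

/-- `Ẑ(1)` is a cyclic `R`-module. -/
lemma smul_generator_surjective {z : ZHat1 K}
    (hz : ∀ m : ℕ+, IsPrimitiveRoot (comp z m) (m : ℕ)) (w : ZHat1 K) : ∃ r : R K, r • z = w := by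
  choose c hc using fun m : ℕ+ => exists_pow_eq_of_isPrimitiveRoot m.pos (hz m) (comp_pow w m)
  obtain ⟨r, hr⟩ := exists_smul_eq_zsmul (K := K) (fun m => (c m : ℤ)) fun n m h => by
    obtain ⟨k, rfl⟩ := h
    rw [← (hz n).zpow_eq_one_iff_dvd, zpow_sub, zpow_natCast, zpow_natCast, ← hc,
      ← comp_mul_pow z n k, ← comp_mul_pow w n k, hc, mul_comm n k, ← pow_mul, ← pow_mul,
      mul_comm (k : ℕ), mul_inv_cancel]
  refine ⟨r, compAb_injective ?_⟩
  rw [compAb_smul]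
  funext m
  rw [Pi.smul_apply, hr m _ (compAb_nsmul z m)]
  apply UAb.unit_injective
  rw [UAb.unit_zsmul, unit_compAb, unit_compAb, hc, zpow_natCast]

/-- The congruence `f ≡ x` modulo torsion, for some `x` in `𝓕ᶜ`, is detected by multiplication by
`1 + τ`. -/
lemma one_add_tau_smul_mem_iff (ι : K →+* ℂ) {f : F K} (hf : f ∈ Fd K) :
    (1 + tau ι) • f ∈ (1 + tau ι) • Fc K ↔ ∃ x ∈ Fc K, IsOfFinAddOrder (x - f) := by
  have hcd : Fc K ≤ Fd K := Fc_le_Fsd.trans Fsd_le_Fd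
  rw [Submodule.mem_smul_pointwise_iff_exists]
  constructor
  · rintro ⟨x, hx, e⟩
    have h1 : x - f ∈ FdTv K := (mem_FdTv_iff ι _).2
      ⟨(Fd K).sub_mem (hcd hx) hf, by rw [smul_sub, e, sub_self]⟩
    rw [FdTv_eq_sup ι, Submodule.mem_sup] at h1
    obtain ⟨a, ha, b, hb, hab⟩ := h1
    have hbc : b ∈ Fc K := by
      obtain ⟨y, hy, rfl⟩ := (Submodule.mem_smul_pointwise_iff_exists _ _ _).1 hb
      exact (Fc K).smul_mem _ hy
    refine ⟨x - b, (Fc K).sub_mem hx hbc, ?_⟩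
    rw [sub_right_comm, ← hab, add_sub_cancel_right]
    exact ((mem_FdTor_iff _).1 ha).2
  · rintro ⟨x, hx, ht⟩
    refine ⟨x, hx, ?_⟩
    have h1 : x - f ∈ FdTor K := (mem_FdTor_iff _).2 ⟨(Fd K).sub_mem (hcd hx) hf, ht⟩
    have h2 := ((mem_FdTv_iff ι _).1 (FdTor_le_FdTv h1)).2
    rwa [smul_sub, sub_eq_zero] at h2

/-! ### Comparison of quotients -/

lemma mkQ_mem_map_mkQ_iff {A M : Type*} [Ring A] [AddCommGroup M] [Module A M]
    (T N : Submodule A M) (f : M) : T.mkQ f ∈ N.map T.mkQ ↔ ∃ x ∈ N, x - f ∈ T := by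
  simp only [Submodule.mem_map, Submodule.mkQ_apply, Submodule.Quotient.eq]

lemma mem_tor_iff {A M : Type*} [CommRing A] [AddCommGroup M] [Module A M] (S : Submodule A M)
    (x : S) : x ∈ tor A S ↔ IsOfFinAddOrder (x : M) := by
  refine ⟨AddMonoidHom.isOfFinAddOrder S.subtype.toAddMonoidHom, fun h => ?_⟩
  obtain ⟨n, hn, e⟩ := h.exists_nsmul_eq_zero
  exact isOfFinAddOrder_iff_nsmul_eq_zero.2 ⟨n, hn, Subtype.ext e⟩

/-- Two surjective linear maps with the same kernel have isomorphic targets. -/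
lemma exists_linearEquiv_of_ker_eq {A M N P : Type*} [Ring A] [AddCommGroup M] [AddCommGroup N]
    [AddCommGroup P] [Module A M] [Module A N] [Module A P] (φ : M →ₗ[A] N) (ψ : M →ₗ[A] P)
    (hφ : Function.Surjective φ) (hψ : Function.Surjective ψ)
    (h : ∀ m, φ m = 0 ↔ ψ m = 0) : ∃ e : N ≃ₗ[A] P, ∀ m, e (φ m) = ψ m := by
  have hker : LinearMap.ker φ = LinearMap.ker ψ := Submodule.ext h
  refine ⟨(φ.quotKerEquivOfSurjective hφ).symm.trans
    ((Submodule.quotEquivOfEq _ _ hker).trans (ψ.quotKerEquivOfSurjective hψ)), fun m => ?_⟩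
  have : (φ.quotKerEquivOfSurjective hφ).symm (φ m) = Submodule.Quotient.mk m := by
    rw [LinearEquiv.symm_apply_eq]; rfl
  rw [LinearEquiv.trans_apply, this]
  rfl

/-- Two cyclic modules whose generators have the same annihilator are isomorphic. -/
lemma exists_linearEquiv_of_annihilator_eq {A N P : Type*} [CommRing A] [AddCommGroup N]
    [AddCommGroup P] [Module A N] [Module A P] (x : N) (y : P) (hx : ∀ n, ∃ r : A, r • x = n)
    (hy : ∀ p, ∃ r : A, r • y = p) (h : ∀ r : A, r • x = 0 ↔ r • y = 0) :
    ∃ e : N ≃ₗ[A] P, e x = y := by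
  obtain ⟨e, he⟩ := exists_linearEquiv_of_ker_eq (LinearMap.toSpanSingleton A N x)
    (LinearMap.toSpanSingleton A P y) hx hy h
  refine ⟨e, ?_⟩
  have := he 1
  rwa [LinearMap.toSpanSingleton_apply, LinearMap.toSpanSingleton_apply, one_smul,
    one_smul] at this

end CircDist

theorem mainTheorem3 {K : Type*} [Field K] [CharZero K] [IsAlgClosure ℚ K] (ι : K →+* ℂ)
    (z : CircDist.ZHat1 K) (hz : ∀ m : ℕ+, IsPrimitiveRoot (CircDist.comp z m) (m : ℕ)) :
    -- (i)
    (CircDist.FdTv K = CircDist.FdTor K ⊔ (1 - CircDist.tau ι) • CircDist.Fc K ∧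
      CircDist.FdTv K =
        (LinearMap.ker (LinearMap.lsmul (CircDist.R K) (CircDist.Fd K) (1 + CircDist.tau ι))).map
          (CircDist.Fd K).subtype) ∧
    -- (ii)
    (∃ (hle : (1 - CircDist.tau ι) • CircDist.Fc K ≤ CircDist.FdTv K)
        (e₁ : (CircDist.FdTv K ⧸ (CircDist.FdTor K).submoduleOf (CircDist.FdTv K))
          ≃ₗ[CircDist.R K] ↥((1 - CircDist.tau ι) • CircDist.Fc K))
        (e₂ : ↥((1 - CircDist.tau ι) • CircDist.Fc K) ≃ₗ[CircDist.R K] CircDist.ZHat1 K),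
      (∀ x : ↥((1 - CircDist.tau ι) • CircDist.Fc K),
        e₁ (Submodule.Quotient.mk (Submodule.inclusion hle x)) = x) ∧
      e₂ ⟨(1 - CircDist.tau ι) • CircDist.Phi K,
        Submodule.smul_mem_pointwise_smul _ _ _ (Submodule.mem_span_singleton_self _)⟩ = z) ∧
    -- (iii)
    (∀ S : Submodule (CircDist.R K) (CircDist.F K), S = CircDist.Fd K ∨ S = CircDist.Fsd K →
      ∃ e : ((↥S ⧸ CircDist.tor (CircDist.R K) S) ⧸
          ((CircDist.Fc K).submoduleOf S).map (CircDist.tor (CircDist.R K) S).mkQ)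
          ≃ₗ[CircDist.R K]
          (↥((1 + CircDist.tau ι) • S) ⧸
            ((1 + CircDist.tau ι) • CircDist.Fc K).submoduleOf ((1 + CircDist.tau ι) • S)),
        ∀ f : S, e (Submodule.Quotient.mk (Submodule.Quotient.mk f)) =
          Submodule.Quotient.mk ⟨(1 + CircDist.tau ι) • (f : CircDist.F K),
            Submodule.smul_mem_pointwise_smul _ _ _ f.2⟩) := by
  open CircDist in
  refine ⟨⟨FdTv_eq_sup ι, ?_⟩, ?_, ?_⟩
  · ext f
    rw [mem_FdTv_iff ι]
    constructor
    · rintro ⟨h, h0⟩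
      exact ⟨⟨f, h⟩, Subtype.ext h0, rfl⟩
    · rintro ⟨x, hx, rfl⟩
      exact ⟨x.2, congrArg Subtype.val (show (1 + tau ι) • x = 0 from hx)⟩
  · have hle := one_sub_tau_smul_Fc_le_FdTv (K := K) ι
    have hmem : (1 - tau ι) • Phi K ∈ (1 - tau ι) • Fc K :=
      Submodule.smul_mem_pointwise_smul _ _ _ (Submodule.mem_span_singleton_self _)
    obtain ⟨e₁, he₁⟩ := exists_linearEquiv_of_ker_eq
      (((FdTor K).submoduleOf (FdTv K)).mkQ ∘ₗ Submodule.inclusion hle) LinearMap.id (by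
        intro y
        obtain ⟨⟨f, hf⟩, rfl⟩ := Submodule.mkQ_surjective _ y
        have hf' := hf
        rw [FdTv_eq_sup ι, Submodule.mem_sup] at hf'
        obtain ⟨a, ha, b, hb, rfl⟩ := hf'
        refine ⟨⟨b, hb⟩, (Submodule.Quotient.eq _).2 ?_⟩
        show b - (a + b) ∈ FdTor K
        rw [sub_add_cancel_right]
        exact (FdTor K).neg_mem ha) Function.surjective_id (by
        intro x
        rw [LinearMap.comp_apply, Submodule.mkQ_apply, Submodule.Quotient.mk_eq_zero]
        refine ⟨fun h => Subtype.ext (FdTor_inf_one_sub_tau_smul_Fc ι h x.2), fun h => ?_⟩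
        have h : x = 0 := h
        rw [h, map_zero]
        exact Submodule.zero_mem _)
    obtain ⟨e₂, he₂⟩ := exists_linearEquiv_of_annihilator_eq
      (⟨(1 - tau ι) • Phi K, hmem⟩ : ↥((1 - tau ι) • Fc K)) z (by
        rintro ⟨f, hf⟩
        obtain ⟨r, rfl⟩ := (mem_smul_Fc_iff _ _).1 hf
        exact ⟨r, rfl⟩) (smul_generator_surjective hz) (by
        intro r
        rw [smul_generator_eq_zero_iff hz, ← smul_one_sub_tau_smul_Phi_eq_zero_iff ι]
        exact Subtype.ext_iff)
    exact ⟨hle, e₁, e₂, he₁, he₂⟩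
  · intro S hS
    have hSd : S ≤ Fd K := by
      rcases hS with rfl | rfl
      exacts [le_rfl, Fsd_le_Fd]
    have hcS : Fc K ≤ S := by
      rcases hS with rfl | rfl
      exacts [Fc_le_Fsd.trans Fsd_le_Fd, Fc_le_Fsd]
    let μ : S →ₗ[R K] ↥((1 + tau ι) • S) :=
      (LinearMap.lsmul (R K) (F K) (1 + tau ι)).restrict fun f hf =>
        Submodule.smul_mem_pointwise_smul _ _ _ hf
    obtain ⟨e, he⟩ := exists_linearEquiv_of_ker_eq
      ((((Fc K).submoduleOf S).map (tor (R K) S).mkQ).mkQ ∘ₗ (tor (R K) S).mkQ)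
      ((((1 + tau ι) • Fc K).submoduleOf ((1 + tau ι) • S)).mkQ ∘ₗ μ)
      ((Submodule.mkQ_surjective _).comp (Submodule.mkQ_surjective _))
      ((Submodule.mkQ_surjective _).comp fun y => by
        obtain ⟨f, hf, e⟩ := (Submodule.mem_smul_pointwise_iff_exists _ _ _).1 y.2
        exact ⟨⟨f, hf⟩, Subtype.ext e⟩) (by
        intro f
        refine (Submodule.Quotient.mk_eq_zero _).trans
          (Iff.trans ?_ (Submodule.Quotient.mk_eq_zero _).symm)
        refine (mkQ_mem_map_mkQ_iff _ _ f).trans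
          (Iff.trans ?_ (one_add_tau_smul_mem_iff ι (hSd f.2)).symm)
        constructor
        · rintro ⟨x, hx, ht⟩
          exact ⟨x, hx, (mem_tor_iff S _).1 ht⟩
        · rintro ⟨x, hx, ht⟩
          exact ⟨⟨x, hcS hx⟩, hx, (mem_tor_iff S _).2 ht⟩)
    exact ⟨e, he⟩
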